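/- Let $\xi$ be a random variable with values in $\{0,1,2,\dots\}$ such that $\mathbb E\,\xi=1$ and $0<\operatorname{Var}\xi<\infty$. Let $\mathcal T$ be the Galton–Watson tree with offspring distribution $\xi$ (a random rooted plane tree) and, for every $n\ge1$ with $\mathbb P(|\mathcal T|=n)>0$, let $T_n$ be $\mathcal T$ conditioned on having exactly $n$ vertices. Let $\hat T_n$ be the fringe subtree of $T_n$ at a vertex $v$ chosen uniformly at random among the $n$ vertices of $T_n$; that is, $\hat T_n$ consists of $v$ and all its descendants and is rooted at $v$. For a finite rooted tree $\tau$ and $k\ge1$, let $P_k(\tau)$ be the number of unordered pairs of vertices of $\tau$ at distance $k$ from each other, and let $Q_k(\tau)$ be the number of those pairs for which the path between the two vertices visits the root of $\tau$ (possibly as an endpoint). Then there exists a constant $C>0$, depending only on the distribution of $\xi$, such that $$\mathbb E\,Q_k(\hat T_n)\le C\,k$$ for all $k\ge1$ and all $n\ge1$ with $\mathbb P(|\mathcal T|=n)>0$. Moreover, this bound is equivalent to the bound $\mathbb E\,P_k(T_n)\le C\,n\,k$, with the same constant: for every constant $C\ge0$, one has $\mathbb E\,Q_k(\hat T_n)\le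 Ck$ for all $k\ge1$ and all $n\ge1$ with $\mathbb P(|\mathcal T|=n)>0$ if and only if $\mathbb E\,P_k(T_n)\le Cnk$ for all such $k$ and $n$. -/

import Mathlib

open MeasureTheory ProbabilityTheory
open scoped ENNReal NNReal

/-- A finite rooted plane (ordered) tree in Ulam–Harris–Neveu notation: a finite set of words,
containing the empty word (the root), closed under taking the parent, and such that the children
of every vertex `v` are `v ++ [0], …, v ++ [d - 1]` for some `d`. -/
structure PlaneTree where
  verts : Finset (List ℕ)
  root_mem : [] ∈ verts
  parent_mem : ∀ v i, v ++ [i] ∈ verts → v ∈ verts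
  sibling_mem : ∀ v i j, j < i → v ++ [i] ∈ verts → v ++ [j] ∈ verts

namespace PlaneTree

/-- The type of vertices of a plane tree. -/
abbrev Vertex (τ : PlaneTree) : Type := {v : List ℕ // v ∈ τ.verts}

/-- The root. -/
def root (τ : PlaneTree) : τ.Vertex := ⟨[], τ.root_mem⟩

instance instNonemptyVertex (τ : PlaneTree) : Nonempty τ.Vertex := ⟨τ.root⟩

/-- The number of vertices, `|τ|`. -/
def size (τ : PlaneTree) : ℕ := τ.verts.card

/-- The underlying graph: the edges join each vertex to its children. -/
def graph (τ : PlaneTree) : SimpleGraph τ.Vertex :=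
  SimpleGraph.fromRel fun v w => ∃ i, w.1 = v.1 ++ [i]

/-- `P_k(τ)`, for `k ≥ 1`: the number of unordered pairs of vertices at graph distance `k`. -/
noncomputable def P (k : ℕ) (τ : PlaneTree) : ℕ :=
  {e : Sym2 τ.Vertex | ∃ v w, e = s(v, w) ∧ τ.graph.dist v w = k}.ncard

/-- `Q_k(τ)`, for `k ≥ 1`: the number of unordered pairs of vertices at graph distance `k` such
that the path between them visits the root (possibly as an endpoint). -/
noncomputable def Q (k : ℕ) (τ : PlaneTree) : ℕ :=
  {e : Sym2 τ.Vertex | ∃ v w, e = s(v, w) ∧ τ.graph.dist v w = k ∧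
    ∃ q : τ.graph.Walk v w, q.IsPath ∧ τ.root ∈ q.support}.ncard

/-- The fringe subtree of `τ` at `v`: the vertex `v` together with all its descendants, rooted
at `v`. A descendant `v ++ u` of `v` is renamed `u`. -/
noncomputable def fringe (τ : PlaneTree) (v : τ.Vertex) : PlaneTree where
  verts := τ.verts.preimage (fun u => v.1 ++ u) (List.append_right_injective v.1).injOn
  root_mem := by simp [v.2]
  parent_mem u i h := by
    rw [Finset.mem_preimage] at h ⊢
    exact τ.parent_mem _ i (by simpa using h)
  sibling_mem u i j hji h := by
    rw [Finset.mem_preimage] at h ⊢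
    simpa using τ.sibling_mem (v.1 ++ u) i j hji (by simpa using h)

/-- The (countable) set of plane trees is given the discrete σ-algebra. -/
instance instMeasurableSpace : MeasurableSpace PlaneTree := ⊤

end PlaneTree

/-- The family tree of a branching process in which the (potential) individual `v` has `x v`
children, named `v ++ [0], …, v ++ [x v - 1]`, and the ancestor is `[]`. It may be infinite. -/
def familyTree (x : List ℕ → ℕ) : Set (List ℕ) :=
  {u | ∀ v i, (v ++ [i]) <+: u → i < x v}

/-- The law of independent offspring numbers, all with distribution `p`. -/
noncomputable def offspringLaw (p : PMF ℕ) : Measure (List ℕ → ℕ) :=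
  Measure.infinitePi fun _ => p.toMeasure

/-- The law of the Galton–Watson tree `𝒯` with offspring distribution `p`, on finite trees:
the mass of each finite plane tree `τ` is the probability that the family tree of independent
individuals with offspring distribution `p` equals `τ`. (The total mass is the probability that
`𝒯` is finite.) -/
noncomputable def gwLaw (p : PMF ℕ) : Measure PlaneTree :=
  Measure.sum fun τ : PlaneTree =>
    offspringLaw p {x | familyTree x = (τ.verts : Set (List ℕ))} • Measure.dirac τ

/-- `T_n` exists, that is, `ℙ(|𝒯| = n) > 0`. -/
def CondTreeExists (p : PMF ℕ) (n : ℕ) : Prop :=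
  0 < gwLaw p {τ | τ.size = n}

/-- The law of the conditioned Galton–Watson tree `T_n`, that is, of `𝒯` given `|𝒯| = n`. -/
noncomputable def condTreeLaw (p : PMF ℕ) (n : ℕ) : Measure PlaneTree :=
  ProbabilityTheory.cond (gwLaw p) {τ | τ.size = n}

/-- The law of the fringe subtree of `T_n` rooted at a vertex that is, given `T_n`, uniformly
distributed over the vertices of `T_n`. -/
noncomputable def randomFringeLaw (p : PMF ℕ) (n : ℕ) : Measure PlaneTree :=
  (condTreeLaw p n).bind fun τ => ((PMF.uniformOfFintype τ.Vertex).map τ.fringe).toMeasure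

/-- The distance between two words in the Ulam–Harris tree. -/
def wordDist : List ℕ → List ℕ → ℕ
  | [], w => w.length
  | u, [] => u.length
  | a :: u, b :: w => if a = b then wordDist u w else u.length + w.length + 2

namespace wordDist

@[simp] theorem nil_left (w : List ℕ) : wordDist [] w = w.length := by
  cases w <;> simp [wordDist]

@[simp] theorem nil_right (w : List ℕ) : wordDist w [] = w.length := by
  cases w <;> simp [wordDist]

@[simp] theorem cons_same (a : ℕ) (u w : List ℕ) :
    wordDist (a :: u) (a :: w) = wordDist u w := by
  simp [wordDist]

theorem cons_ne {a b : ℕ} (h : a ≠ b) (u w : List ℕ) :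
    wordDist (a :: u) (b :: w) = u.length + w.length + 2 := by
  simp [wordDist, h]

theorem le_length_add (u w : List ℕ) : wordDist u w ≤ u.length + w.length := by
  induction u generalizing w with
  | nil => simp
  | cons a u ih =>
    cases w with
    | nil => simp
    | cons b w =>
      by_cases h : a = b
      · subst h
        have := ih w
        simp only [cons_same, List.length_cons]; omega
      · simp only [cons_ne h, List.length_cons]; omega

@[simp] theorem self (u : List ℕ) : wordDist u u = 0 := by
  induction u <;> simp_all

theorem symm (u w : List ℕ) : wordDist u w = wordDist w u := by
  induction u generalizing w with
  | nil => simp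
  | cons a u ih =>
    cases w with
    | nil => simp
    | cons b w =>
      by_cases h : a = b
      · subst h; simp [ih w]
      · rw [cons_ne h, cons_ne (Ne.symm h)]; omega

@[simp] theorem append_left (v u w : List ℕ) : wordDist (v ++ u) (v ++ w) = wordDist u w := by
  induction v <;> simp_all

theorem concat_le (u w : List ℕ) (i : ℕ) :
    wordDist (u ++ [i]) w ≤ wordDist u w + 1 ∧ wordDist u w ≤ wordDist (u ++ [i]) w + 1 := by
  induction u generalizing w with
  | nil =>
    cases w with
    | nil => simp
    | cons b w =>
      by_cases h : i = b
      · subst h; simp; omega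
      · simp [cons_ne h]
  | cons a u ih =>
    cases w with
    | nil => simp
    | cons b w =>
      by_cases h : a = b
      · subst h; simpa using ih w
      · simp only [List.cons_append, cons_ne h, List.length_append, List.length_cons,
          List.length_nil]
        omega

/-- Two words split off at their longest common prefix. -/
theorem exists_append (u w : List ℕ) : ∃ v x y, u = v ++ x ∧ w = v ++ y ∧
    wordDist x y = x.length + y.length := by
  induction u generalizing w with
  | nil => exact ⟨[], [], w, by simp⟩
  | cons a u ih =>
    cases w with
    | nil => exact ⟨[], a :: u, [], by simp⟩
    | cons b w =>
      by_cases h : a = b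
      · subst h
        obtain ⟨v, x, y, rfl, rfl, h⟩ := ih w
        exact ⟨a :: v, x, y, by simp [h]⟩
      · exact ⟨[], a :: u, b :: w, by simp [cons_ne h]; omega⟩

theorem prefix_unique {v v' x x' y y' : List ℕ} (h : wordDist x y = x.length + y.length)
    (h' : wordDist x' y' = x'.length + y'.length) (hx : v ++ x = v' ++ x')
    (hy : v ++ y = v' ++ y') : v = v' ∧ x = x' ∧ y = y' := by
  induction v generalizing v' with
  | nil =>
    cases v' with
    | nil => simpa using ⟨hx, hy⟩
    | cons b v' =>
      simp only [List.nil_append, List.cons_append] at hx hy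
      subst hx hy
      simp only [cons_same, append_left, List.length_cons, List.length_append] at h
      omega
  | cons a v ih =>
    cases v' with
    | nil =>
      simp only [List.nil_append, List.cons_append] at hx hy
      subst hx hy
      simp only [cons_same, append_left, List.length_cons, List.length_append] at h'
      omega
    | cons b v' =>
      simp only [List.cons_append, List.cons.injEq] at hx hy
      obtain ⟨rfl, h1, h2⟩ := ih hx.2 hy.2
      exact ⟨by rw [hx.1], h1, h2⟩

end wordDist

namespace PlaneTree

variable {τ : PlaneTree}

theorem mem_of_append_mem {v x : List ℕ} (h : v ++ x ∈ τ.verts) : v ∈ τ.verts := by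
  induction x using List.reverseRecOn with
  | nil => simpa using h
  | append_singleton x i ih => exact ih (τ.parent_mem _ i (by simpa using h))

theorem adj_iff {v w : τ.Vertex} :
    τ.graph.Adj v w ↔ (∃ i, w.1 = v.1 ++ [i]) ∨ ∃ i, v.1 = w.1 ++ [i] := by
  rw [graph, SimpleGraph.fromRel_adj, and_iff_right_iff_imp]
  rintro (⟨i, h⟩ | ⟨i, h⟩) rfl <;> simpa using congrArg List.length h

theorem wordDist_le_length {v w : τ.Vertex} (q : τ.graph.Walk v w) :
    wordDist v.1 w.1 ≤ q.length := by
  induction q with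
  | nil => simp
  | @cons u v w h q ih =>
    rw [SimpleGraph.Walk.length_cons]
    obtain ⟨i, h⟩ | ⟨i, h⟩ := adj_iff.1 h
    · have := (wordDist.concat_le u.1 w.1 i).2
      rw [← h] at this
      omega
    · have := (wordDist.concat_le v.1 w.1 i).1
      rw [← h] at this
      omega

theorem exists_walk_append (v x : List ℕ) (h : v ++ x ∈ τ.verts) :
    ∃ q : τ.graph.Walk ⟨v, mem_of_append_mem h⟩ ⟨v ++ x, h⟩, q.length = x.length := by
  induction x using List.reverseRecOn with
  | nil =>
    have : (⟨v, mem_of_append_mem h⟩ : τ.Vertex) = ⟨v ++ [], h⟩ := by simp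
    exact ⟨SimpleGraph.Walk.nil.copy rfl this, by simp⟩
  | append_singleton x i ih =>
    have h' : v ++ x ∈ τ.verts := τ.parent_mem _ i (by simpa using h)
    obtain ⟨q, hq⟩ := ih h'
    have hadj : τ.graph.Adj ⟨v ++ x, h'⟩ ⟨v ++ (x ++ [i]), h⟩ :=
      adj_iff.2 (Or.inl ⟨i, by simp⟩)
    exact ⟨q.concat hadj, by simp [hq]⟩

theorem exists_walk_through {v x y : List ℕ} (hx : v ++ x ∈ τ.verts) (hy : v ++ y ∈ τ.verts) :
    ∃ q : τ.graph.Walk ⟨v ++ x, hx⟩ ⟨v ++ y, hy⟩, q.length = x.length + y.length ∧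
      ⟨v, mem_of_append_mem hx⟩ ∈ q.support := by
  obtain ⟨q, hq⟩ := exists_walk_append v x hx
  obtain ⟨r, hr⟩ := exists_walk_append v y hy
  refine ⟨q.reverse.append r, by simp [hq, hr], ?_⟩
  rw [SimpleGraph.Walk.mem_support_append_iff]
  exact Or.inr r.start_mem_support

theorem dist_eq (v w : τ.Vertex) : τ.graph.dist v w = wordDist v.1 w.1 := by
  obtain ⟨v, hv⟩ := v
  obtain ⟨w, hw⟩ := w
  obtain ⟨u, x, y, rfl, rfl, h⟩ := wordDist.exists_append v w
  obtain ⟨q, hq, -⟩ := exists_walk_through hv hw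
  refine le_antisymm ?_ ?_
  · rw [wordDist.append_left, h, ← hq]
    exact τ.graph.dist_le q
  · obtain ⟨r, hr⟩ := q.reachable.exists_walk_length_eq_dist
    rw [← hr]
    exact wordDist_le_length r

/-- A walk that leaves the fringe subtree at `[a]` visits `[a]`. -/
theorem mem_support_of_leave {a : ℕ} {v w : τ.Vertex} (q : τ.graph.Walk v w)
    (hv : [a] <+: v.1) (hw : ¬ [a] <+: w.1) :
    ∃ h : [a] ∈ τ.verts, (⟨[a], h⟩ : τ.Vertex) ∈ q.support := by
  induction q with
  | nil => exact absurd hv hw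
  | @cons u v w h q ih =>
    by_cases hv' : [a] <+: v.1
    · obtain ⟨h, hs⟩ := ih hv' hw
      exact ⟨h, by simp [hs]⟩
    · obtain ⟨i, h⟩ | ⟨i, h⟩ := adj_iff.1 h
      · exact absurd (hv.trans ⟨[i], h.symm⟩) hv'
      · have hu : u.1 = [a] := by
          rw [h] at hv ⊢
          cases hvv : v.1 with
          | nil => simpa [hvv, eq_comm] using hv
          | cons b t =>
            rw [hvv] at hv hv'
            simp_all
        refine ⟨hu ▸ u.2, ?_⟩
        simp [← hu]

theorem path_through_root_iff (v w : τ.Vertex) :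
    (∃ q : τ.graph.Walk v w, q.IsPath ∧ τ.root ∈ q.support) ↔
      wordDist v.1 w.1 = v.1.length + w.1.length := by
  constructor
  · rintro ⟨q, hq, hr⟩
    by_contra hne
    obtain ⟨v, hv⟩ := v
    obtain ⟨w, hw⟩ := w
    obtain ⟨u, x, y, rfl, rfl, h⟩ := wordDist.exists_append v w
    cases u with
    | nil => simp_all
    | cons a u =>
      have hroot : ¬ [a] <+: (τ.root).1 := by simp [root]
      obtain ⟨ha, h1⟩ := mem_support_of_leave (a := a) (q.takeUntil _ hr) (by simp) hroot
      obtain ⟨_, h2⟩ := mem_support_of_leave (a := a) (q.dropUntil _ hr).reverse (by simp) hroot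
      rw [SimpleGraph.Walk.support_reverse, List.mem_reverse] at h2
      have hsp := q.take_spec hr
      rw [← hsp, SimpleGraph.Walk.isPath_def, SimpleGraph.Walk.support_append] at hq
      have hne : (⟨[a], ha⟩ : τ.Vertex) ≠ τ.root := by simp [root, Subtype.ext_iff]
      have h3 := (SimpleGraph.Walk.mem_support_iff _).1 h2
      exact List.disjoint_of_nodup_append hq h1 (h3.resolve_left hne)
  · intro h
    obtain ⟨v, hv⟩ := v
    obtain ⟨w, hw⟩ := w
    obtain ⟨q, hq, hs⟩ := exists_walk_through (v := []) hv hw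
    refine ⟨q, q.isPath_of_length_eq_dist ?_, hs⟩
    rw [dist_eq, hq]
    exact h.symm

end PlaneTree

theorem two_mul_ncard_sym2 {α : Type*} [Fintype α] (r : α → α → Prop)
    (hs : ∀ a b, r a b → r b a) (hi : ∀ a, ¬ r a a) :
    2 * {e : Sym2 α | ∃ v w, e = s(v, w) ∧ r v w}.ncard =
      {x : α × α | r x.1 x.2}.ncard := by
  classical
  let G : SimpleGraph α := { Adj := r, symm := ⟨hs⟩, loopless := ⟨hi⟩ }
  have h1 : {e : Sym2 α | ∃ v w, e = s(v, w) ∧ r v w} = (G.edgeFinset : Set (Sym2 α)) := by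
    ext e
    induction e with | _ v w
    simp only [Set.mem_ofPred_eq, SimpleGraph.coe_edgeFinset, SimpleGraph.mem_edgeSet]
    constructor
    · rintro ⟨a, b, h, hr⟩
      obtain ⟨rfl, rfl⟩ | ⟨rfl, rfl⟩ := Sym2.eq_iff.1 h
      exacts [hr, hs _ _ hr]
    · exact fun h => ⟨v, w, rfl, h⟩
  rw [h1, Set.ncard_coe_finset, ← G.dart_card_eq_twice_card_edges, ← Nat.card_eq_fintype_card,
    ← Nat.card_coe_set_eq]
  exact Nat.card_congr
    { toFun := fun d => ⟨d.toProd, d.adj⟩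
      invFun := fun x => ⟨x.1, x.2⟩
      left_inv := fun d => rfl
      right_inv := fun x => rfl }

namespace PlaneTree

/-- The ordered pairs of vertices at distance `k`. -/
def orderedPairs (k : ℕ) (τ : PlaneTree) : Finset (List ℕ × List ℕ) :=
  (τ.verts ×ˢ τ.verts).filter fun x => wordDist x.1 x.2 = k

/-- The ordered pairs of vertices at distance `k` whose path visits the root. -/
def rootPairs (k : ℕ) (τ : PlaneTree) : Finset (List ℕ × List ℕ) :=
  (τ.verts ×ˢ τ.verts).filter fun x => wordDist x.1 x.2 = k ∧ x.1.length + x.2.length = k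

theorem ncard_vertex_pairs (τ : PlaneTree) (r : List ℕ × List ℕ → Prop) [DecidablePred r] :
    {x : τ.Vertex × τ.Vertex | r (x.1.1, x.2.1)}.ncard =
      ((τ.verts ×ˢ τ.verts).filter r).card := by
  rw [← Set.ncard_coe_finset, ← Set.ncard_image_of_injective _
    (Function.Injective.prodMap Subtype.val_injective Subtype.val_injective)]
  congr 1
  ext ⟨u, w⟩
  simp only [Set.mem_image, Set.mem_ofPred_eq, Prod.exists, Prod.map_apply, Prod.mk.injEq,
    Subtype.exists, Finset.coe_filter, Finset.mem_product]
  constructor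
  · rintro ⟨a, ha, b, hb, h, rfl, rfl⟩
    exact ⟨⟨ha, hb⟩, h⟩
  · rintro ⟨⟨ha, hb⟩, h⟩
    exact ⟨u, ha, w, hb, h, rfl, rfl⟩

theorem two_mul_P {k : ℕ} (hk : 1 ≤ k) (τ : PlaneTree) : 2 * τ.P k = (τ.orderedPairs k).card := by
  rw [P, two_mul_ncard_sym2, orderedPairs, ← ncard_vertex_pairs]
  · simp only [dist_eq]
  · intro a b h
    rwa [SimpleGraph.dist_comm]
  · intro a h
    rw [SimpleGraph.dist_self] at h
    omega

theorem two_mul_Q {k : ℕ} (hk : 1 ≤ k) (τ : PlaneTree) : 2 * τ.Q k = (τ.rootPairs k).card := by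
  simp only [Q, path_through_root_iff, dist_eq]
  rw [two_mul_ncard_sym2, rootPairs, ← ncard_vertex_pairs]
  · congr 1
    ext x
    simp only [Set.mem_ofPred_eq]
    constructor
    · rintro ⟨rfl, h⟩; exact ⟨rfl, h.symm⟩
    · rintro ⟨rfl, h⟩; exact ⟨rfl, h.symm⟩
  · intro a b h
    rw [wordDist.symm b.1 a.1]
    exact ⟨h.1, h.2.trans (add_comm _ _)⟩
  · intro a h
    rw [wordDist.self] at h
    omega

theorem P_eq_sum_Q {k : ℕ} (hk : 1 ≤ k) (τ : PlaneTree) :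
    τ.P k = ∑ v : τ.Vertex, (τ.fringe v).Q k := by
  refine Nat.eq_of_mul_eq_mul_left two_pos ?_
  rw [two_mul_P hk, Finset.mul_sum]
  simp only [two_mul_Q hk]
  rw [← Finset.card_sigma]
  symm
  refine Finset.card_bij (fun z _ => (z.1.1 ++ z.2.1, z.1.1 ++ z.2.2)) ?_ ?_ ?_
  · rintro ⟨v, x, y⟩ h
    simp only [rootPairs, orderedPairs, Finset.mem_sigma, Finset.mem_filter, Finset.mem_product,
      fringe, Finset.mem_preimage, wordDist.append_left] at h ⊢
    exact ⟨h.2.1, h.2.2.1⟩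
  · rintro ⟨⟨v, hv⟩, x, y⟩ h ⟨⟨v', hv'⟩, x', y'⟩ h' heq
    simp only [rootPairs, Finset.mem_sigma, Finset.mem_filter] at h h'
    simp only [Prod.mk.injEq] at heq
    obtain ⟨rfl, rfl, rfl⟩ := wordDist.prefix_unique (h.2.2.1.trans h.2.2.2.symm)
      (h'.2.2.1.trans h'.2.2.2.symm) heq.1 heq.2
    rfl
  · rintro ⟨u, w⟩ h
    obtain ⟨v, x, y, rfl, rfl, hxy⟩ := wordDist.exists_append u w
    simp only [orderedPairs, Finset.mem_filter, Finset.mem_product, wordDist.append_left] at h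
    refine ⟨⟨⟨v, mem_of_append_mem h.1.1⟩, x, y⟩, ?_, rfl⟩
    simp only [rootPairs, Finset.mem_sigma, Finset.mem_filter, Finset.mem_product,
      fringe, Finset.mem_preimage, Finset.mem_univ, true_and]
    exact ⟨h.1, h.2, hxy ▸ h.2⟩

end PlaneTree

namespace PlaneTree

@[ext] theorem ext {σ τ : PlaneTree} (h : ∀ u, u ∈ σ.verts ↔ u ∈ τ.verts) : σ = τ := by
  cases σ; cases τ
  congr 1
  exact Finset.ext h

/-- The number of children of `v` in `τ`. -/
noncomputable def outdegree (τ : PlaneTree) (v : List ℕ) : ℕ :=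
  sInf {i | v ++ [i] ∉ τ.verts}

theorem append_mem_iff (τ : PlaneTree) (v : List ℕ) (i : ℕ) :
    v ++ [i] ∈ τ.verts ↔ i < τ.outdegree v := by
  have hne : {i | v ++ [i] ∉ τ.verts}.Nonempty := by
    have hinj : Function.Injective fun i : ℕ => v ++ [i] := fun i j h => by simpa using h
    obtain ⟨i, hi⟩ := Set.Infinite.exists_notMem_finset
      (Set.infinite_range_of_injective hinj) τ.verts
    obtain ⟨⟨j, rfl⟩, hi⟩ := hi
    exact ⟨j, hi⟩
  constructor
  · intro h
    by_contra! hle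
    have hmem : v ++ [τ.outdegree v] ∉ τ.verts := Nat.sInf_mem hne
    obtain hlt | heq := hle.lt_or_eq
    · exact hmem (τ.sibling_mem v i _ hlt h)
    · exact hmem (heq ▸ h)
  · intro h
    by_contra hmem
    exact Nat.notMem_of_lt_sInf h hmem

theorem outdegree_eq {τ : PlaneTree} {v : List ℕ} {d : ℕ}
    (h : ∀ i, v ++ [i] ∈ τ.verts ↔ i < d) : τ.outdegree v = d := by
  refine le_antisymm (not_lt.1 fun hlt => ?_) (not_lt.1 fun hlt => ?_)
  · exact lt_irrefl d ((h d).1 ((append_mem_iff _ _ _).2 hlt))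
  · exact lt_irrefl _ ((append_mem_iff _ _ _).1 ((h _).2 hlt))

/-- The tree whose root has the root branches `f 0, …, f (d - 1)`. -/
def node (d : ℕ) (f : Fin d → PlaneTree) : PlaneTree where
  verts := insert [] (Finset.univ.biUnion fun a : Fin d =>
    (f a).verts.map ⟨List.cons (a : ℕ), List.cons_injective⟩)
  root_mem := by simp
  parent_mem v i h := by
    cases v with
    | nil => simp
    | cons b v =>
      simp only [List.cons_append, Finset.mem_insert, reduceCtorEq, Finset.mem_biUnion,
        Finset.mem_univ, Finset.mem_map, Function.Embedding.coeFn_mk, List.cons.injEq, true_and,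
        false_or] at h ⊢
      obtain ⟨a, u, hu, rfl, rfl⟩ := h
      exact ⟨a, v, (f a).parent_mem _ i hu, rfl, rfl⟩
  sibling_mem v i j hji h := by
    cases v with
    | nil =>
      simp only [List.nil_append, Finset.mem_insert, reduceCtorEq, Finset.mem_biUnion,
        Finset.mem_univ, Finset.mem_map, Function.Embedding.coeFn_mk, List.cons.injEq, true_and,
        false_or] at h ⊢
      obtain ⟨a, u, hu, rfl, rfl⟩ := h
      exact ⟨⟨j, hji.trans a.2⟩, [], (f _).root_mem, rfl, rfl⟩
    | cons b v =>
      simp only [List.cons_append, Finset.mem_insert, reduceCtorEq, Finset.mem_biUnion,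
        Finset.mem_univ, Finset.mem_map, Function.Embedding.coeFn_mk, List.cons.injEq, true_and,
        false_or] at h ⊢
      obtain ⟨a, u, hu, rfl, rfl⟩ := h
      exact ⟨a, _, (f a).sibling_mem _ i j hji hu, rfl, rfl⟩

section node

variable {d : ℕ} {f : Fin d → PlaneTree}

theorem cons_mem_node {i : ℕ} {u : List ℕ} :
    i :: u ∈ (node d f).verts ↔ ∃ h : i < d, u ∈ (f ⟨i, h⟩).verts := by
  simp only [node, Finset.mem_insert, reduceCtorEq, Finset.mem_biUnion, Finset.mem_univ,
    Finset.mem_map, Function.Embedding.coeFn_mk, List.cons.injEq, true_and, false_or]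
  constructor
  · rintro ⟨a, u, hu, rfl, rfl⟩
    exact ⟨a.2, hu⟩
  · rintro ⟨h, hu⟩
    exact ⟨⟨i, h⟩, u, hu, rfl, rfl⟩

theorem coe_cons_mem_node {a : Fin d} {u : List ℕ} :
    (a : ℕ) :: u ∈ (node d f).verts ↔ u ∈ (f a).verts := by
  simp [cons_mem_node]

@[to_additive]
theorem prod_node {M : Type*} [CommMonoid M] (g : List ℕ → M) :
    ∏ v ∈ (node d f).verts, g v = g [] * ∏ a, ∏ u ∈ (f a).verts, g (a :: u) := by
  rw [node, Finset.prod_insert (by simp), Finset.prod_biUnion]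
  · simp
  · intro a _ b _ hab
    rw [Function.onFun, Finset.disjoint_left]
    rintro u hu hu'
    simp only [Finset.mem_map, Function.Embedding.coeFn_mk] at hu hu'
    obtain ⟨x, -, rfl⟩ := hu
    obtain ⟨y, -, h⟩ := hu'
    simp only [List.cons.injEq] at h
    exact hab (Fin.ext h.1.symm)

theorem size_node : (node d f).size = ∑ a, (f a).size + 1 := by
  simp only [size, Finset.card_eq_sum_ones, sum_node]
  rw [add_comm]

theorem outdegree_node_nil : (node d f).outdegree [] = d :=
  outdegree_eq fun i => by
    rw [List.nil_append, cons_mem_node]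
    exact ⟨fun h => h.1, fun h => ⟨h, root_mem _⟩⟩

theorem outdegree_node_cons (a : Fin d) (u : List ℕ) :
    (node d f).outdegree (a :: u) = (f a).outdegree u :=
  outdegree_eq fun i => by rw [List.cons_append, coe_cons_mem_node, append_mem_iff]

end node

theorem node_injective :
    Function.Injective fun x : (Σ d, Fin d → PlaneTree) => node x.1 x.2 := by
  rintro ⟨d, f⟩ ⟨d', f'⟩ h
  dsimp only at h
  obtain rfl : d = d' := by rw [← outdegree_node_nil (f := f), h, outdegree_node_nil]
  congr 1
  funext a
  ext u
  rw [← coe_cons_mem_node (f := f), h, coe_cons_mem_node]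

theorem exists_eq_node (τ : PlaneTree) : ∃ d f, τ = node d f := by
  have hmem (i : Fin (τ.outdegree [])) : [(i : ℕ)] ∈ τ.verts := (τ.append_mem_iff [] i).2 i.2
  refine ⟨τ.outdegree [], fun i => τ.fringe ⟨[i], hmem i⟩, ?_⟩
  ext u
  cases u with
  | nil => simp [root_mem]
  | cons i u =>
    rw [cons_mem_node]
    simp only [fringe, Finset.mem_preimage, List.cons_append, List.nil_append]
    refine ⟨fun h => ⟨(τ.append_mem_iff [] i).1 ?_, h⟩, fun h => h.2⟩
    exact mem_of_append_mem (v := [i]) (x := u) h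

/-- A plane tree is given by the sequence of the branches at its root. -/
noncomputable def nodeEquiv : (Σ d, Fin d → PlaneTree) ≃ PlaneTree :=
  Equiv.ofBijective (fun x => node x.1 x.2) ⟨node_injective, fun τ => by
    obtain ⟨d, f, rfl⟩ := τ.exists_eq_node
    exact ⟨⟨d, f⟩, rfl⟩⟩

/-- The sum of `g` over all fringe subtrees of `τ`. -/
noncomputable def fringeSum {M : Type*} [AddCommMonoid M] (g : PlaneTree → M) (τ : PlaneTree) : M :=
  ∑ v : τ.Vertex, g (τ.fringe v)

theorem fringe_root (τ : PlaneTree) : τ.fringe τ.root = τ := by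
  ext u
  simp [fringe, root]

theorem fringeSum_node {M : Type*} [AddCommMonoid M] (g : PlaneTree → M) (d : ℕ)
    (f : Fin d → PlaneTree) :
    fringeSum g (node d f) = g (node d f) + ∑ a, fringeSum g (f a) := by
  classical
  let sub (τ : PlaneTree) (v : List ℕ) : PlaneTree := if h : v ∈ τ.verts then τ.fringe ⟨v, h⟩ else τ
  have hsub (τ : PlaneTree) : fringeSum g τ = ∑ v ∈ τ.verts, g (sub τ v) := by
    rw [fringeSum, ← Finset.sum_coe_sort τ.verts fun v => g (sub τ v)]
    exact Finset.sum_congr rfl fun v _ => by simp [sub]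
  rw [hsub, sum_node]
  congr 1
  · simp only [sub, root_mem, dite_true]
    exact congrArg g (fringe_root _)
  · refine Finset.sum_congr rfl fun a _ => ?_
    rw [hsub]
    refine Finset.sum_congr rfl fun u hu => ?_
    have hu' : (a : ℕ) :: u ∈ (node d f).verts := coe_cons_mem_node.2 hu
    simp only [sub, hu, hu', dite_true]
    congr 1
    ext w
    simp only [fringe, Finset.mem_preimage, List.cons_append, coe_cons_mem_node]

/-- The number of vertices at distance `i` from the root. -/
def level (i : ℕ) (τ : PlaneTree) : ℕ := (τ.verts.filter fun v => v.length = i).card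

theorem level_eq_sum (i : ℕ) (τ : PlaneTree) :
    τ.level i = ∑ v ∈ τ.verts, if v.length = i then 1 else 0 := by
  rw [level, Finset.card_filter]

theorem level_zero (τ : PlaneTree) : τ.level 0 = 1 := by
  obtain ⟨d, f, rfl⟩ := τ.exists_eq_node
  simp only [level_eq_sum, sum_node, List.length_nil, List.length_cons]
  simp

theorem level_succ_node (i d : ℕ) (f : Fin d → PlaneTree) :
    (node d f).level (i + 1) = ∑ a, (f a).level i := by
  simp only [level_eq_sum, sum_node, List.length_nil, List.length_cons]
  simp

theorem rootPairs_card_eq_sum (k : ℕ) (τ : PlaneTree) :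
    (τ.rootPairs k).card = ∑ u ∈ τ.verts, ∑ w ∈ τ.verts,
      if wordDist u w = k ∧ u.length + w.length = k then 1 else 0 := by
  rw [rootPairs, Finset.card_filter, Finset.sum_product]

theorem rootPairs_card_node (k d : ℕ) (f : Fin d → PlaneTree) :
    ((node d f).rootPairs (k + 1)).card = 2 * (node d f).level (k + 1) +
      ∑ a, ∑ b ∈ Finset.univ.erase a, ∑ u ∈ (f a).verts, ∑ w ∈ (f b).verts,
        if u.length + w.length + 1 = k then 1 else 0 := by
  classical
  have hcross (a b : Fin d) (u w : List ℕ) :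
      (if wordDist (a :: u) (b :: w) = k + 1 ∧
        (List.cons (a : ℕ) u).length + (List.cons (b : ℕ) w).length = k + 1 then 1 else 0) =
      if b = a then 0 else if u.length + w.length + 1 = k then 1 else 0 := by
    by_cases h : b = a
    · subst h
      have := wordDist.le_length_add u w
      simp only [wordDist.cons_same, List.length_cons, if_true, ite_eq_right_iff]
      intro
      omega
    · have h' : (a : ℕ) ≠ b := fun h' => h (Fin.ext h'.symm)
      simp only [wordDist.cons_ne h', List.length_cons, if_neg h]
      congr 1
      apply propext
      omega
  rw [rootPairs_card_eq_sum, sum_node]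
  simp only [sum_node, hcross]
  rw [level_succ_node]
  simp only [level_eq_sum, wordDist.nil_left, wordDist.nil_right, List.length_nil,
    List.length_cons, Finset.sum_add_distrib, and_self, zero_add, add_zero, add_left_inj]
  rw [if_neg (by omega), zero_add, two_mul, add_assoc]
  congr 2
  refine Finset.sum_congr rfl fun a _ => ?_
  rw [Finset.sum_comm, ← Finset.add_sum_erase _ _ (Finset.mem_univ a)]
  simp only [if_true, Finset.sum_const_zero, zero_add]
  refine Finset.sum_congr rfl fun b hb => ?_
  simp only [if_neg (Finset.ne_of_mem_erase hb)]

theorem rootPairs_one_card (τ : PlaneTree) : (τ.rootPairs 1).card = 2 * τ.level 1 := by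
  obtain ⟨d, f, rfl⟩ := τ.exists_eq_node
  rw [← zero_add 1, rootPairs_card_node]
  simp

theorem rootPairs_add_two_card_node (k d : ℕ) (f : Fin d → PlaneTree) :
    ((node d f).rootPairs (k + 2)).card = 2 * (node d f).level (k + 2) +
      ∑ ij ∈ Finset.HasAntidiagonal.antidiagonal k, ∑ a, ∑ b ∈ Finset.univ.erase a,
        (f a).level ij.1 * (f b).level ij.2 := by
  rw [rootPairs_card_node]
  congr 1
  symm
  rw [Finset.sum_comm]
  refine Finset.sum_congr rfl fun a _ => ?_
  rw [Finset.sum_comm]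
  refine Finset.sum_congr rfl fun b _ => ?_
  simp only [level_eq_sum, Finset.sum_mul_sum]
  rw [Finset.sum_comm]
  refine Finset.sum_congr rfl fun u _ => ?_
  rw [Finset.sum_comm]
  refine Finset.sum_congr rfl fun w _ => ?_
  have (ij : ℕ × ℕ) : (if u.length = ij.1 then 1 else 0) * (if w.length = ij.2 then 1 else 0) =
      if (u.length, w.length) = ij then 1 else 0 := by
    simp [Prod.ext_iff, ← ite_and, and_comm]
  simp only [this, Finset.sum_ite_eq, Finset.HasAntidiagonal.mem_antidiagonal, add_left_inj]

/-- The weight of `τ`: the probability of the offspring numbers that it prescribes. -/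
noncomputable def weight (p : ℕ → ℝ≥0∞) (τ : PlaneTree) : ℝ≥0∞ :=
  ∏ v ∈ τ.verts, p (τ.outdegree v)

theorem weight_node (p : ℕ → ℝ≥0∞) (d : ℕ) (f : Fin d → PlaneTree) :
    (node d f).weight p = p d * ∏ a, (f a).weight p := by
  simp only [weight, prod_node, outdegree_node_nil, outdegree_node_cons]

end PlaneTree

open PowerSeries Finset.HasAntidiagonal

/-- The generating function `∑ i, f i * X ^ s i`. -/
noncomputable def genFun {ι : Type*} (s : ι → ℕ) (f : ι → ℝ≥0∞) : PowerSeries ℝ≥0∞ :=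
  PowerSeries.mk fun n => ∑' i, if s i = n then f i else 0

namespace genFun

variable {ι κ : Type*}

theorem coeff_eq (s : ι → ℕ) (f : ι → ℝ≥0∞) (n : ℕ) :
    coeff n (genFun s f) = ∑' i, if s i = n then f i else 0 := coeff_mk _ _

theorem mul_eq (s : ι → ℕ) (f : ι → ℝ≥0∞) (t : κ → ℕ) (g : κ → ℝ≥0∞) :
    genFun s f * genFun t g =
      genFun (fun x : ι × κ => s x.1 + t x.2) fun x => f x.1 * g x.2 := by
  ext n
  simp only [coeff_mul, coeff_eq, ← ENNReal.tsum_mul_right, ← ENNReal.tsum_mul_left]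
  rw [ENNReal.tsum_prod', ENNReal.tsum_comm, ← Summable.tsum_finsetSum fun _ _ => ENNReal.summable]
  refine tsum_congr fun j => ?_
  rw [← Summable.tsum_finsetSum fun _ _ => ENNReal.summable]
  refine tsum_congr fun i => ?_
  have (ij : ℕ × ℕ) : (if s i = ij.1 then f i else 0) * (if t j = ij.2 then g j else 0) =
      if (s i, t j) = ij then f i * g j else 0 := by
    simp only [Prod.ext_iff, ite_and]
    split_ifs <;> simp
  simp only [this, Finset.sum_ite_eq, mem_antidiagonal]

theorem equiv (e : κ ≃ ι) (s : ι → ℕ) (f : ι → ℝ≥0∞) :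
    genFun (fun x => s (e x)) (fun x => f (e x)) = genFun s f := by
  ext n
  simp only [coeff_eq]
  exact e.tsum_eq fun i => if s i = n then f i else 0

theorem prod_eq (s : ι → ℕ) (d : ℕ) (f : Fin d → ι → ℝ≥0∞) :
    ∏ a, genFun s (f a) =
      genFun (fun x : Fin d → ι => ∑ a, s (x a)) fun x => ∏ a, f a (x a) := by
  induction d with
  | zero =>
    ext n
    simp [coeff_eq, coeff_one, eq_comm]
  | succ d ih =>
    rw [Fin.prod_univ_succ, ih, mul_eq, ← equiv (Fin.consEquiv fun _ : Fin (d + 1) => ι)]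
    simp [Fin.sum_univ_succ, Fin.prod_univ_succ, Fin.consEquiv]

end genFun

/-- The sum of a sequence of power series with coefficients in `[0, ∞]`. -/
noncomputable def seriesSum (f : ℕ → PowerSeries ℝ≥0∞) : PowerSeries ℝ≥0∞ :=
  PowerSeries.mk fun n => ∑' d, coeff n (f d)

namespace seriesSum

theorem coeff_eq (f : ℕ → PowerSeries ℝ≥0∞) (n : ℕ) :
    coeff n (seriesSum f) = ∑' d, coeff n (f d) := coeff_mk _ _

theorem mul_right (f : ℕ → PowerSeries ℝ≥0∞) (g : PowerSeries ℝ≥0∞) :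
    seriesSum f * g = seriesSum fun d => f d * g := by
  ext n
  simp only [coeff_mul, coeff_eq, ← ENNReal.tsum_mul_right]
  rw [← Summable.tsum_finsetSum fun _ _ => ENNReal.summable]

theorem eq_add (f : ℕ → PowerSeries ℝ≥0∞) :
    seriesSum f = f 0 + seriesSum fun d => f (d + 1) := by
  ext n
  simp only [map_add, coeff_eq]
  exact tsum_eq_zero_add' ENNReal.summable

end seriesSum

/-- A linear equation `R = G + X * B * R` has at most one solution. -/
theorem eq_of_eq_add_X_mul {B G R S : PowerSeries ℝ≥0∞} (hR : R = G + X * B * R)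
    (hS : S = G + X * B * S) : R = S := by
  ext n
  induction n using Nat.strong_induction_on with
  | _ n ih =>
    rw [hR, hS]
    simp only [map_add]
    congr 1
    rw [mul_assoc, mul_assoc]
    cases n with
    | zero => simp
    | succ n =>
      rw [coeff_succ_X_mul, coeff_succ_X_mul, coeff_mul, coeff_mul]
      refine Finset.sum_congr rfl fun ij hij => ?_
      rw [ih]
      have := mem_antidiagonal.1 hij
      omega

/-- The geometric series `1 / (1 - B)`. -/
noncomputable def geomSeries (B : PowerSeries ℝ≥0∞) : PowerSeries ℝ≥0∞ :=
  seriesSum fun l => B ^ l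

theorem geomSeries_eq (B : PowerSeries ℝ≥0∞) : geomSeries B = 1 + B * geomSeries B := by
  conv_lhs => rw [geomSeries, seriesSum.eq_add]
  rw [pow_zero, mul_comm B, geomSeries, seriesSum.mul_right]
  simp only [pow_succ]

theorem eq_mul_geomSeries {B G R : PowerSeries ℝ≥0∞} (hR : R = G + X * B * R) :
    R = G * geomSeries (X * B) := by
  refine eq_of_eq_add_X_mul hR ?_
  conv_lhs => rw [geomSeries_eq]
  ring

theorem coeff_pow_mul_geomSeries_le (B G : PowerSeries ℝ≥0∞) (l n : ℕ) :
    coeff n (B ^ l * G * geomSeries B) ≤ coeff n (G * geomSeries B) := by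
  induction l with
  | zero => simp
  | succ l ih =>
    refine le_trans ?_ ih
    conv_rhs => rw [geomSeries_eq]
    have : B ^ l * G * (1 + B * geomSeries B) =
      B ^ l * G + B ^ (l + 1) * G * geomSeries B := by ring
    rw [this, map_add]
    exact le_add_self

namespace PlaneTree

/-- The generating function of the family of plane trees, with the weight of the tree `τ`
multiplied by `g τ`. -/
noncomputable def treeGenFun (p : ℕ → ℝ≥0∞) (g : PlaneTree → ℝ≥0∞) : PowerSeries ℝ≥0∞ :=
  genFun size fun τ => τ.weight p * g τ

variable (p : ℕ → ℝ≥0∞)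

theorem coeff_treeGenFun (g : PlaneTree → ℝ≥0∞) (n : ℕ) :
    coeff n (treeGenFun p g) = ∑' τ : PlaneTree, if τ.size = n then τ.weight p * g τ else 0 :=
  genFun.coeff_eq _ _ _

theorem treeGenFun_add (g h : PlaneTree → ℝ≥0∞) :
    treeGenFun p (fun τ => g τ + h τ) = treeGenFun p g + treeGenFun p h := by
  ext n
  simp only [map_add, coeff_treeGenFun]
  rw [← ENNReal.tsum_add]
  refine tsum_congr fun τ => ?_
  split_ifs
  · exact mul_add _ _ _
  · simp

theorem treeGenFun_const_mul (c : ℝ≥0∞) (g : PlaneTree → ℝ≥0∞) :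
    treeGenFun p (fun τ => c * g τ) = PowerSeries.C c * treeGenFun p g := by
  ext n
  simp only [coeff_C_mul, coeff_treeGenFun]
  rw [← ENNReal.tsum_mul_left]
  refine tsum_congr fun τ => ?_
  split_ifs
  · exact mul_left_comm _ _ _
  · simp

theorem treeGenFun_sum {ι : Type*} (S : Finset ι) (g : ι → PlaneTree → ℝ≥0∞) :
    treeGenFun p (fun τ => ∑ i ∈ S, g i τ) = ∑ i ∈ S, treeGenFun p (g i) := by
  ext n
  simp only [map_sum, coeff_treeGenFun]
  rw [← Summable.tsum_finsetSum fun _ _ => ENNReal.summable]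
  refine tsum_congr fun τ => ?_
  split_ifs
  · exact Finset.mul_sum _ _ _
  · simp

/-- Decomposition of a generating function at the root, for a functional that is a sum of products
of functionals of the branches at the root. -/
theorem treeGenFun_node {ι : ℕ → Type*} (S : ∀ d, Finset (ι d))
    (h : ∀ d, ι d → Fin d → PlaneTree → ℝ≥0∞) (g : PlaneTree → ℝ≥0∞)
    (hg : ∀ d f, g (node d f) = ∑ c ∈ S d, ∏ a, h d c a (f a)) :
    treeGenFun p g = PowerSeries.X * seriesSum fun d =>
      PowerSeries.C (p d) * ∑ c ∈ S d, ∏ a, treeGenFun p (h d c a) := by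
  have hpos (τ : PlaneTree) : τ.size ≠ 0 := Finset.card_ne_zero_of_mem τ.root_mem
  ext n
  cases n with
  | zero => simp [coeff_treeGenFun, hpos]
  | succ n =>
    rw [coeff_succ_X_mul, coeff_treeGenFun, ← nodeEquiv.tsum_eq, ENNReal.tsum_sigma',
      seriesSum.coeff_eq]
    refine tsum_congr fun d => ?_
    simp only [coeff_C_mul, map_sum, treeGenFun, genFun.prod_eq, genFun.coeff_eq]
    rw [← Summable.tsum_finsetSum fun _ _ => ENNReal.summable, ← ENNReal.tsum_mul_left]
    refine tsum_congr fun f => ?_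
    have hnode : nodeEquiv ⟨d, f⟩ = node d f := rfl
    simp only [hnode, size_node, weight_node, hg, add_left_inj]
    split_ifs
    · simp only [Finset.prod_mul_distrib, ← Finset.mul_sum, mul_assoc]
    · simp

/-- The sum of `g` over the branches at the root. -/
noncomputable def branchSum (g : PlaneTree → ℝ≥0∞) (τ : PlaneTree) : ℝ≥0∞ :=
  ∑ a, g ((nodeEquiv.symm τ).2 a)

/-- The sum of `g σ * h σ'` over the ordered pairs of distinct branches at the root. -/
noncomputable def branchPairSum (g h : PlaneTree → ℝ≥0∞) (τ : PlaneTree) : ℝ≥0∞ :=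
  ∑ a, ∑ b ∈ Finset.univ.erase a, g ((nodeEquiv.symm τ).2 a) * h ((nodeEquiv.symm τ).2 b)

theorem nodeEquiv_symm_node (d : ℕ) (f : Fin d → PlaneTree) :
    nodeEquiv.symm (node d f) = ⟨d, f⟩ :=
  nodeEquiv.symm_apply_apply ⟨d, f⟩

theorem branchSum_node (g : PlaneTree → ℝ≥0∞) (d : ℕ) (f : Fin d → PlaneTree) :
    branchSum g (node d f) = ∑ a, g (f a) := by
  rw [branchSum, nodeEquiv_symm_node]

theorem branchPairSum_node (g h : PlaneTree → ℝ≥0∞) (d : ℕ) (f : Fin d → PlaneTree) :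
    branchPairSum g h (node d f) = ∑ a, ∑ b ∈ Finset.univ.erase a, g (f a) * h (f b) := by
  rw [branchPairSum, nodeEquiv_symm_node]

end PlaneTree

theorem prod_ite_eq_single {M : Type*} [CommMonoid M] {d : ℕ} (a : Fin d) (x y : M) :
    (∏ c, if c = a then y else x) = x ^ (d - 1) * y := by
  rw [← Finset.prod_erase_mul _ _ (Finset.mem_univ a), if_pos rfl,
    Finset.prod_congr rfl fun c hc => if_neg (Finset.ne_of_mem_erase hc)]
  simp

theorem prod_ite_eq_pair {M : Type*} [CommMonoid M] {d : ℕ} {a b : Fin d} (hab : b ≠ a)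
    (x y z : M) :
    (∏ c, if c = a then y else if c = b then z else x) = x ^ (d - 2) * y * z := by
  rw [← Finset.prod_erase_mul _ _ (Finset.mem_univ a), if_pos rfl,
    Finset.prod_congr rfl fun c hc => if_neg (Finset.ne_of_mem_erase hc),
    ← Finset.prod_erase_mul _ _ (Finset.mem_erase.2 ⟨hab, Finset.mem_univ b⟩), if_pos rfl,
    Finset.prod_congr rfl fun c hc => if_neg (Finset.ne_of_mem_erase hc)]
  simp [Finset.card_erase_of_mem, hab, mul_right_comm, Nat.sub_sub]

namespace PlaneTree

variable (p : ℕ → ℝ≥0∞)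

/-- The generating function `∑ |τ|=n w(τ) X ^ n`. -/
noncomputable def treeSeries : PowerSeries ℝ≥0∞ := treeGenFun p fun _ => 1

theorem treeSeries_eq : treeSeries p = PowerSeries.X * seriesSum fun d =>
    PowerSeries.C (p d) * treeSeries p ^ d := by
  conv_lhs => rw [treeSeries, treeGenFun_node p (ι := fun _ => Unit) (fun _ => Finset.univ)
    (fun _ _ _ _ => 1) _ (by simp)]
  simp [treeSeries]

/-- The generating function of a root together with one marked root branch, to be grafted. -/
noncomputable def spineSeries : PowerSeries ℝ≥0∞ :=
  seriesSum fun d => PowerSeries.C (p d * d) * treeSeries p ^ (d - 1)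

/-- The generating function of a root together with two marked root branches, to be grafted. -/
noncomputable def forkSeries : PowerSeries ℝ≥0∞ :=
  seriesSum fun d => PowerSeries.C (p d * (d * (d - 1) : ℕ)) * treeSeries p ^ (d - 2)

theorem treeGenFun_branchSum (g : PlaneTree → ℝ≥0∞) :
    treeGenFun p (branchSum g) = PowerSeries.X * spineSeries p * treeGenFun p g := by
  rw [treeGenFun_node p (ι := fun d => Fin d) (fun _ => Finset.univ)
    (fun d c a => if a = c then g else fun _ => 1) _ fun d f => ?_]
  · rw [mul_assoc, spineSeries, seriesSum.mul_right]
    congr 2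
    funext d
    simp only [apply_ite (treeGenFun p), prod_ite_eq_single]
    simp only [Finset.sum_const, Finset.card_univ, Fintype.card_fin, map_mul, treeSeries, map_natCast,
      nsmul_eq_mul]
    ring
  · rw [branchSum_node]
    refine Finset.sum_congr rfl fun c _ => ?_
    have (a : Fin d) : (if a = c then g else fun _ => 1) (f a) = if a = c then g (f c) else 1 := by
      split_ifs with h
      · rw [h]
      · rfl
    simp only [this, prod_ite_eq_single, one_pow, one_mul]

theorem treeGenFun_branchPairSum (g h : PlaneTree → ℝ≥0∞) :
    treeGenFun p (branchPairSum g h) =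
      PowerSeries.X * forkSeries p * treeGenFun p g * treeGenFun p h := by
  rw [treeGenFun_node p (ι := fun d => Fin d × Fin d)
    (fun d => (Finset.univ : Finset (Fin d)).offDiag)
    (fun d c a => if a = c.1 then g else if a = c.2 then h else fun _ => 1) _ fun d f => ?_]
  · rw [mul_assoc, mul_assoc, forkSeries, seriesSum.mul_right]
    congr 2
    funext d
    simp only [apply_ite (treeGenFun p)]
    rw [Finset.sum_congr rfl fun c hc => prod_ite_eq_pair (Finset.mem_offDiag.1 hc).2.2.symm _ _ _]
    simp only [Finset.sum_const, Finset.offDiag_card, Finset.card_univ, Fintype.card_fin, map_mul,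
      treeSeries, map_natCast, nsmul_eq_mul, Nat.mul_sub, mul_one]
    ring
  · rw [branchPairSum_node, ← Finset.sum_finset_product' (Finset.univ : Finset (Fin d)).offDiag
      Finset.univ (fun a => Finset.univ.erase a) (by simp [eq_comm])]
    refine Finset.sum_congr rfl fun c hc => ?_
    have (a : Fin d) : (if a = c.1 then g else if a = c.2 then h else fun _ => 1) (f a) =
        if a = c.1 then g (f c.1) else if a = c.2 then h (f c.2) else 1 := by
      split_ifs with h h'
      · rw [h]
      · rw [h']
      · rfl
    simp only [this, prod_ite_eq_pair (Finset.mem_offDiag.1 hc).2.2.symm, one_pow, one_mul]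

theorem treeGenFun_fringeSum (g : PlaneTree → ℝ≥0∞) :
    treeGenFun p (fringeSum g) =
      treeGenFun p g * geomSeries (PowerSeries.X * spineSeries p) := by
  refine eq_mul_geomSeries ?_
  rw [← treeGenFun_branchSum, ← treeGenFun_add]
  congr 1
  funext τ
  obtain ⟨d, f, rfl⟩ := τ.exists_eq_node
  rw [fringeSum_node, branchSum_node]

theorem treeGenFun_level (i : ℕ) : treeGenFun p (fun τ => (τ.level i : ℝ≥0∞)) =
    (PowerSeries.X * spineSeries p) ^ i * treeSeries p := by
  induction i with
  | zero => simp [level_zero, treeSeries]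
  | succ i ih =>
    rw [pow_succ', mul_assoc, ← ih, ← treeGenFun_branchSum]
    congr 1
    funext τ
    obtain ⟨d, f, rfl⟩ := τ.exists_eq_node
    rw [level_succ_node, branchSum_node, Nat.cast_sum]

theorem treeGenFun_rootPairs_one : treeGenFun p (fun τ => ((τ.rootPairs 1).card : ℝ≥0∞)) =
    PowerSeries.C 2 * (PowerSeries.X * spineSeries p * treeSeries p) := by
  simp only [rootPairs_one_card, Nat.cast_mul, Nat.cast_ofNat]
  rw [treeGenFun_const_mul, treeGenFun_level, pow_one]

theorem treeGenFun_rootPairs_add_two (k : ℕ) :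
    treeGenFun p (fun τ => ((τ.rootPairs (k + 2)).card : ℝ≥0∞)) =
      PowerSeries.C 2 * ((PowerSeries.X * spineSeries p) ^ (k + 2) * treeSeries p) +
      PowerSeries.C (k + 1 : ℝ≥0∞) * ((PowerSeries.X * spineSeries p) ^ k *
        (PowerSeries.X * forkSeries p * treeSeries p * treeSeries p)) := by
  have (τ : PlaneTree) : ((τ.rootPairs (k + 2)).card : ℝ≥0∞) = 2 * τ.level (k + 2) +
      ∑ ij ∈ antidiagonal k,
        branchPairSum (fun τ => τ.level ij.1) (fun τ => τ.level ij.2) τ := by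
    obtain ⟨d, f, rfl⟩ := τ.exists_eq_node
    rw [rootPairs_add_two_card_node]
    push_cast [branchPairSum_node]
    rfl
  simp only [this]
  rw [treeGenFun_add, treeGenFun_const_mul, treeGenFun_level, treeGenFun_sum]
  congr 1
  rw [Finset.sum_congr rfl (g := fun _ => (PowerSeries.X * spineSeries p) ^ k *
    (PowerSeries.X * forkSeries p * treeSeries p * treeSeries p)) fun ij hij => ?_]
  · simp
  · rw [treeGenFun_branchPairSum, treeGenFun_level, treeGenFun_level, ← mem_antidiagonal.1 hij]
    ring

end PlaneTree

theorem tsum_mul_ite_coeff (q : ℕ → ℝ≥0∞) (A : PowerSeries ℝ≥0∞) (n k : ℕ) :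
    ∑' d, q d * (if d + k ≤ n then coeff (n - (d + k)) A else 0) =
      if k ≤ n then coeff (n - k) (PowerSeries.mk q * A) else 0 := by
  split_ifs with h
  · rw [coeff_mul, Finset.Nat.sum_antidiagonal_eq_sum_range_succ_mk,
      tsum_eq_sum (s := Finset.range (n - k + 1))]
    · refine Finset.sum_congr rfl fun d hd => ?_
      have hd := Finset.mem_range.1 hd
      rw [if_pos (by omega), coeff_mk, Nat.sub_sub, add_comm k d]
    · intro d hd
      rw [Finset.mem_range] at hd
      rw [if_neg (by omega), mul_zero]
  · refine ENNReal.tsum_eq_zero.2 fun d => ?_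
    rw [if_neg (by omega), mul_zero]

/-- The derivative of a power, one coefficient at a time. -/
theorem coeff_succ_pow_succ (p : ℕ → ℝ≥0∞) (n : ℕ) :
    coeff (n + 1) (PowerSeries.mk p ^ (n + 1)) =
      coeff n (PowerSeries.mk (fun d => p (d + 1) * (d + 1 : ℕ)) * PowerSeries.mk p ^ n) := by
  have h := congrArg (coeff n) (PowerSeries.derivative_pow (PowerSeries.mk p) (n + 1))
  have hd : PowerSeries.derivative ℝ≥0∞ (PowerSeries.mk p) =
      PowerSeries.mk (fun d => p (d + 1) * (d + 1 : ℕ)) := by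
    ext d
    simp [coeff_derivative]
  rw [hd, coeff_derivative, mul_assoc, ← map_natCast (PowerSeries.C (R := ℝ≥0∞)), coeff_C_mul,
    mul_comm] at h
  simp only [Nat.add_sub_cancel, Nat.cast_add, Nat.cast_one] at h
  rw [mul_comm (PowerSeries.mk p ^ n)] at h
  exact_mod_cast (ENNReal.mul_right_inj (by simp) (by finiteness)).1 h

namespace PlaneTree

variable (p : ℕ → ℝ≥0∞)

/-- **Lagrange inversion** for the generating function of weighted plane trees. -/
theorem coeff_treeSeries_pow_mul_geomSeries (n k : ℕ) :
    coeff n (treeSeries p ^ k * geomSeries (PowerSeries.X * spineSeries p)) =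
      if k ≤ n then coeff (n - k) (PowerSeries.mk p ^ n) else 0 := by
  induction n generalizing k with
  | zero =>
    cases k with
    | zero =>
      rw [geomSeries_eq, mul_assoc]
      simp
    | succ k =>
      conv_lhs => rw [pow_succ', mul_assoc, treeSeries_eq, mul_assoc]
      simp
  | succ n ih =>
    cases k with
    | zero =>
      rw [pow_zero, one_mul, geomSeries_eq]
      generalize geomSeries (PowerSeries.X * spineSeries p) = H at ih ⊢
      rw [mul_assoc, map_add, coeff_succ_X_mul, if_pos (Nat.zero_le _), Nat.sub_zero, coeff_succ_pow_succ, spineSeries, seriesSum.mul_right,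
        seriesSum.coeff_eq, tsum_eq_zero_add' ENNReal.summable, coeff_one]
      simp only [mul_assoc, coeff_C_mul, ih, Nat.add_sub_cancel]
      have := tsum_mul_ite_coeff (fun d => p (d + 1) * (d + 1 : ℕ)) (PowerSeries.mk p ^ n) n 0
      simp only [add_zero, Nat.zero_le, if_true, Nat.sub_zero] at this
      rw [← this]
      simp [mul_assoc]
    | succ k =>
      have hk : treeSeries p ^ (k + 1) * geomSeries (PowerSeries.X * spineSeries p) =
          PowerSeries.X * seriesSum fun d => PowerSeries.C (p d) *
            (treeSeries p ^ (d + k) * geomSeries (PowerSeries.X * spineSeries p)) := by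
        rw [pow_succ', mul_assoc]
        conv_lhs => enter [1]; rw [treeSeries_eq]
        rw [mul_assoc, seriesSum.mul_right]
        congr 2
        funext d
        ring
      rw [hk, coeff_succ_X_mul, seriesSum.coeff_eq]
      simp only [coeff_C_mul, ih, tsum_mul_ite_coeff, Nat.add_le_add_iff_right,
        Nat.add_sub_add_right, ← pow_succ']

theorem fringeSum_one (τ : PlaneTree) : fringeSum (fun _ => (1 : ℝ≥0∞)) τ = τ.size := by
  simp [fringeSum, size]

/-- The total weight of the trees with `n + 1` vertices, times `n + 1`, is the weight of the
offspring sequences of length `n + 1` with sum `n`. -/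
theorem tsum_weight_size (n : ℕ) :
    ((n + 1 : ℕ) : ℝ≥0∞) * ∑' τ : PlaneTree, (if τ.size = n + 1 then τ.weight p else 0) =
      coeff n (PowerSeries.mk p ^ (n + 1)) := by
  have h := coeff_treeSeries_pow_mul_geomSeries p (n + 1) 1
  rw [pow_one, treeSeries, ← treeGenFun_fringeSum, coeff_treeGenFun, if_pos (by omega),
    Nat.add_sub_cancel] at h
  rw [← h, ← ENNReal.tsum_mul_left]
  refine tsum_congr fun τ => ?_
  split_ifs with hτ
  · rw [fringeSum_one, hτ, mul_comm]
  · simp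

theorem coeff_fork_mul_geomSeries (n : ℕ) :
    coeff (n + 1) (PowerSeries.X * forkSeries p * treeSeries p * treeSeries p *
      geomSeries (PowerSeries.X * spineSeries p)) =
      coeff n (PowerSeries.mk (fun d => p d * (d * (d - 1) : ℕ)) * PowerSeries.mk p ^ n) := by
  have h : PowerSeries.X * forkSeries p * treeSeries p * treeSeries p *
      geomSeries (PowerSeries.X * spineSeries p) = PowerSeries.X * seriesSum fun d =>
        PowerSeries.C (p d * (d * (d - 1) : ℕ)) *
          (treeSeries p ^ d * geomSeries (PowerSeries.X * spineSeries p)) := by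
    rw [mul_assoc, mul_assoc, mul_assoc, forkSeries, seriesSum.mul_right]
    congr 2
    funext d
    obtain _ | _ | d := d
    · simp
    · simp
    · rw [show d + 1 + 1 - 2 = d by omega]
      ring
  rw [h, coeff_succ_X_mul, seriesSum.coeff_eq]
  simp only [coeff_C_mul, coeff_treeSeries_pow_mul_geomSeries]
  simpa using tsum_mul_ite_coeff (fun d => p d * (d * (d - 1) : ℕ)) (PowerSeries.mk p ^ n) n 0

/-- The key estimate: in a weighted count, the two spines of a pair of vertices at distance `k`
can be moved above the vertex where they split. -/
theorem tsum_fringeSum_rootPairs_le {k : ℕ} (hk : 1 ≤ k) (n : ℕ) :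
    ∑' τ : PlaneTree, (if τ.size = n + 1 then
      τ.weight p * fringeSum (fun σ => ((σ.rootPairs k).card : ℝ≥0∞)) τ else 0) ≤
      2 * coeff n (PowerSeries.mk p ^ (n + 1)) + k *
        coeff n (PowerSeries.mk (fun d => p d * (d * (d - 1) : ℕ)) * PowerSeries.mk p ^ n) := by
  have h1 := coeff_treeSeries_pow_mul_geomSeries p (n + 1) 1
  rw [pow_one, if_pos (by omega), Nat.add_sub_cancel] at h1
  rw [← coeff_treeGenFun, treeGenFun_fringeSum, ← coeff_fork_mul_geomSeries, ← h1]
  obtain _ | _ | k := k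
  · omega
  · rw [zero_add, treeGenFun_rootPairs_one, mul_assoc, coeff_C_mul]
    refine le_add_right ?_
    gcongr
    simpa using coeff_pow_mul_geomSeries_le (PowerSeries.X * spineSeries p) (treeSeries p) 1 (n + 1)
  · rw [treeGenFun_rootPairs_add_two, add_mul, mul_assoc, mul_assoc (PowerSeries.C (k + 1 : ℝ≥0∞)),
      map_add, coeff_C_mul, coeff_C_mul]
    gcongr
    · exact coeff_pow_mul_geomSeries_le _ _ _ _
    · push_cast
      exact le_self_add
    · exact coeff_pow_mul_geomSeries_le _ _ _ _

end PlaneTree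

open Filter Topology

theorem coeff_mk_pow_nonneg {q : ℕ → ℝ} (h0 : ∀ d, 0 ≤ q d) (n m : ℕ) :
    0 ≤ coeff m (PowerSeries.mk q ^ n) := by
  induction n generalizing m with
  | zero =>
    rw [pow_zero, coeff_one]
    split_ifs <;> norm_num
  | succ n ih =>
    rw [pow_succ', coeff_mul]
    exact Finset.sum_nonneg fun ij _ => mul_nonneg (by rw [coeff_mk]; exact h0 _) (ih _)

/-- The value at `w` of the probability generating function. -/
noncomputable def pgf (q : ℕ → ℝ) (w : ℂ) : ℂ := ∑' d, (q d : ℂ) * w ^ d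

section pgf

variable {q : ℕ → ℝ}

theorem norm_pgf_term_le (h0 : ∀ d, 0 ≤ q d) {w : ℂ} (hw : ‖w‖ ≤ 1) (d : ℕ) :
    ‖(q d : ℂ) * w ^ d‖ ≤ q d := by
  rw [norm_mul, norm_pow, Complex.norm_real, Real.norm_of_nonneg (h0 d)]
  exact mul_le_of_le_one_right (h0 d) (pow_le_one₀ (norm_nonneg _) hw)

theorem summable_norm_pgf (h0 : ∀ d, 0 ≤ q d) (hq : Summable q) {w : ℂ} (hw : ‖w‖ ≤ 1) :
    Summable fun d => ‖(q d : ℂ) * w ^ d‖ :=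
  hq.of_nonneg_of_le (fun _ => norm_nonneg _) (norm_pgf_term_le h0 hw)

theorem summable_norm_pgf_pow (h0 : ∀ d, 0 ≤ q d) (hq : Summable q) {w : ℂ} (hw : ‖w‖ ≤ 1)
    (n : ℕ) :
    (Summable fun m => ‖((coeff m (PowerSeries.mk q ^ n) : ℝ) : ℂ) * w ^ m‖) ∧
      ∑' m, ((coeff m (PowerSeries.mk q ^ n) : ℝ) : ℂ) * w ^ m = pgf q w ^ n := by
  induction n with
  | zero =>
    have h (m : ℕ) (hm : m ≠ 0) :
        ((coeff m (PowerSeries.mk q ^ 0) : ℝ) : ℂ) * w ^ m = 0 := by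
      simp [coeff_one, hm]
    refine ⟨summable_of_ne_finset_zero (s := {0}) fun m hm => ?_, ?_⟩
    · rw [h m (by simpa using hm), norm_zero]
    · rw [tsum_eq_single 0 h]
      simp
  | succ n ih =>
    have h (m : ℕ) : ((coeff m (PowerSeries.mk q ^ (n + 1)) : ℝ) : ℂ) * w ^ m =
        ∑ ij ∈ antidiagonal m, ((q ij.1 : ℂ) * w ^ ij.1) *
          (((coeff ij.2 (PowerSeries.mk q ^ n) : ℝ) : ℂ) * w ^ ij.2) := by
      rw [pow_succ', coeff_mul]
      push_cast
      rw [Finset.sum_mul]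
      refine Finset.sum_congr rfl fun ij hij => ?_
      rw [coeff_mk, ← mem_antidiagonal.1 hij, pow_add]
      ring
    have hs := summable_norm_sum_mul_antidiagonal_of_summable_norm (summable_norm_pgf h0 hq hw) ih.1
    have ht := tsum_mul_tsum_eq_tsum_sum_antidiagonal_of_summable_norm
      (summable_norm_pgf h0 hq hw) ih.1
    rw [ih.2, ← pgf, ← pow_succ'] at ht
    rw [ht]
    exact ⟨hs.congr fun m => congrArg norm (h m).symm, tsum_congr h⟩

theorem hasSum_coeff_mk_pow (h0 : ∀ d, 0 ≤ q d) (hq : HasSum q 1) (n : ℕ) :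
    HasSum (fun m => coeff m (PowerSeries.mk q ^ n)) 1 := by
  have h1 : pgf q 1 = 1 := by
    simp only [pgf, one_pow, mul_one]
    rw [← Complex.ofReal_tsum, hq.tsum_eq, Complex.ofReal_one]
  have h := summable_norm_pgf_pow h0 hq.summable (w := 1) (by simp) n
  rw [h1, one_pow] at h
  have h2 := h.1.of_norm.hasSum
  rw [h.2] at h2
  simp only [one_pow, mul_one] at h2
  simpa using Complex.hasSum_re h2

theorem continuous_pgf_exp (h0 : ∀ d, 0 ≤ q d) (hq : Summable q) :
    Continuous fun t : ℝ => pgf q (Complex.exp (t * Complex.I)) := by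
  refine continuous_tsum (u := q) (fun d => by fun_prop) hq fun d t => ?_
  exact norm_pgf_term_le h0 (Complex.norm_exp_ofReal_mul_I t).le d

theorem norm_pgf_le_one (h0 : ∀ d, 0 ≤ q d) (hq : HasSum q 1) {w : ℂ} (hw : ‖w‖ ≤ 1) :
    ‖pgf q w‖ ≤ 1 :=
  tsum_of_norm_bounded hq (norm_pgf_term_le h0 hw)

/-- If the generating function has modulus `1` on the unit circle and `0` is an atom, then every
atom gives the value `1`. -/
theorem pow_eq_one_of_norm_pgf_eq_one (h0 : ∀ d, 0 ≤ q d) (hq : HasSum q 1) (hq0 : q 0 ≠ 0)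
    {w : ℂ} (hw : ‖w‖ = 1) (h : ‖pgf q w‖ = 1) {d : ℕ} (hd : q d ≠ 0) : w ^ d = 1 := by
  set z := pgf q w
  have hsum : HasSum (fun d => (q d : ℂ) * w ^ d) z :=
    (summable_norm_pgf h0 hq.summable hw.le).of_norm.hasSum
  have h1 : HasSum (fun d => q d - ((starRingEnd ℂ) z * ((q d : ℂ) * w ^ d)).re) 0 := by
    have h2 := Complex.hasSum_re (hsum.mul_left ((starRingEnd ℂ) z))
    rw [mul_comm _ z, Complex.mul_conj, Complex.normSq_eq_norm_sq, h] at h2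
    simpa using hq.sub h2
  have hre (d : ℕ) : ((starRingEnd ℂ) z * ((q d : ℂ) * w ^ d)).re =
      q d * ((starRingEnd ℂ) z * w ^ d).re := by
    rw [mul_left_comm, Complex.re_ofReal_mul]
  have hnorm (d : ℕ) : ‖(starRingEnd ℂ) z * w ^ d‖ = 1 := by
    rw [norm_mul, norm_pow, hw, one_pow, mul_one, RCLike.norm_conj, h]
  have hle (d : ℕ) : ((starRingEnd ℂ) z * w ^ d).re ≤ 1 :=
    (Complex.re_le_norm _).trans (hnorm d).le
  have h3 := (hasSum_zero_iff_of_nonneg fun d => by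
    rw [hre, ← mul_one_sub]
    exact mul_nonneg (h0 d) (sub_nonneg.2 (hle d))).1 h1
  have key (d : ℕ) (hd : q d ≠ 0) : (starRingEnd ℂ) z * w ^ d = 1 := by
    have h4 := congrFun h3 d
    simp only [hre, Pi.zero_apply, ← mul_one_sub, mul_eq_zero, hd, false_or] at h4
    have hre1 : ((starRingEnd ℂ) z * w ^ d).re = 1 := by linarith
    have hsq := Complex.normSq_eq_norm_sq ((starRingEnd ℂ) z * w ^ d)
    rw [hnorm, Complex.normSq_apply, hre1] at hsq
    refine Complex.ext hre1 ?_
    rw [Complex.one_im]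
    nlinarith
  have hk0 := key 0 hq0
  rw [pow_zero, mul_one] at hk0
  simpa [hk0] using key d hd

end pgf

/-- The lattice generated by a set of natural numbers, and its dual. -/
theorem exists_span (s : Set ℕ) (hs : ∃ d ∈ s, d ≠ 0) : ∃ h : ℕ, 0 < h ∧ (∀ d ∈ s, h ∣ d) ∧
    ∀ w : ℂ, w ≠ 0 → (∀ d ∈ s, w ^ d = 1) → w ^ h = 1 := by
  obtain ⟨a, ha⟩ := Int.subgroup_cyclic (AddSubgroup.closure ((fun d : ℕ => (d : ℤ)) '' s))
  have hdvd : ∀ d ∈ s, a.natAbs ∣ d := fun d hd => by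
    have : (d : ℤ) ∈ AddSubgroup.closure {a} := by
      rw [← ha]
      exact AddSubgroup.subset_closure ⟨d, hd, rfl⟩
    rw [AddSubgroup.mem_closure_singleton] at this
    obtain ⟨k, hk⟩ := this
    rw [← Int.natCast_dvd_natCast, Int.natAbs_dvd]
    exact ⟨k, by rw [← hk, smul_eq_mul, mul_comm]⟩
  refine ⟨a.natAbs, ?_, hdvd, fun w hw h => ?_⟩
  · obtain ⟨d, hd, hd0⟩ := hs
    exact Nat.pos_of_dvd_of_pos (hdvd d hd) (Nat.pos_of_ne_zero hd0)
  · have hmem : (a.natAbs : ℤ) ∈ AddSubgroup.closure ((fun d : ℕ => (d : ℤ)) '' s) := by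
      rw [ha, AddSubgroup.mem_closure_singleton]
      exact ⟨a.sign, by rw [smul_eq_mul, Int.sign_mul_self_eq_natAbs]⟩
    have hz : ∀ x ∈ AddSubgroup.closure ((fun d : ℕ => (d : ℤ)) '' s), w ^ x = 1 := by
      intro x hx
      induction hx using AddSubgroup.closure_induction with
      | mem x hx =>
        obtain ⟨d, hd, rfl⟩ := hx
        exact_mod_cast h d hd
      | zero => simp
      | add x y _ _ hx hy => rw [zpow_add₀ hw, hx, hy, one_mul]
      | neg x _ hx => rw [zpow_neg, hx, inv_one]
    exact_mod_cast hz _ hmem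

theorem dvd_of_coeff_mk_pow_ne_zero {R : Type*} [CommSemiring R] {q : ℕ → R} {h : ℕ}
    (hd : ∀ d, q d ≠ 0 → h ∣ d) {n m : ℕ} (hm : coeff m (PowerSeries.mk q ^ n) ≠ 0) : h ∣ m := by
  induction n generalizing m with
  | zero =>
    rw [pow_zero, coeff_one] at hm
    obtain rfl : m = 0 := by by_contra h0; simp [h0] at hm
    exact dvd_zero _
  | succ n ih =>
    rw [pow_succ', coeff_mul] at hm
    obtain ⟨ij, hij, hne⟩ := Finset.exists_ne_zero_of_sum_ne_zero hm
    rw [← mem_antidiagonal.1 hij]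
    rw [coeff_mk] at hne
    exact dvd_add (hd _ (left_ne_zero_of_mul hne)) (ih (right_ne_zero_of_mul hne))

theorem integral_exp_lattice {h : ℕ} (hh : 0 < h) (l : ℤ) :
    ∫ t in (-(Real.pi / h))..(Real.pi / h), Complex.exp (t * (h * l : ℤ) * Complex.I) =
      if l = 0 then ((2 * Real.pi / h : ℝ) : ℂ) else 0 := by
  have hh' : (h : ℂ) ≠ 0 := by exact_mod_cast hh.ne'
  split_ifs with hl
  · subst hl
    simp only [mul_zero, Int.cast_zero, zero_mul, Complex.exp_zero, intervalIntegral.integral_const]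
    rw [Complex.real_smul, mul_one]
    congr 1
    ring
  · have hc : ((h * l : ℤ) : ℂ) * Complex.I ≠ 0 := by
      push_cast
      simp [hh', hl]
    have h1 (t : ℝ) : Complex.exp (t * (h * l : ℤ) * Complex.I) =
        Complex.exp (((h * l : ℤ) : ℂ) * Complex.I * t) := by
      congr 1; ring
    simp only [h1]
    rw [integral_exp_mul_complex hc]
    have h2 : Complex.exp (((h * l : ℤ) : ℂ) * Complex.I * ((Real.pi / h : ℝ) : ℂ)) =
        Complex.exp (((h * l : ℤ) : ℂ) * Complex.I * ((-(Real.pi / h) : ℝ) : ℂ)) := by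
      rw [Complex.exp_eq_exp_iff_exists_int]
      refine ⟨l, ?_⟩
      push_cast
      field_simp
      ring
    rw [h2, sub_self, zero_div]

/-- Fourier inversion for the convolution powers of a lattice distribution. -/
theorem integral_pgf_pow {q : ℕ → ℝ} (h0 : ∀ d, 0 ≤ q d) (hq : HasSum q 1) {h : ℕ} (hh : 0 < h)
    (hd : ∀ d, q d ≠ 0 → h ∣ d) (n : ℕ) {m : ℕ} (hm : h ∣ m) :
    ∫ t in (-(Real.pi / h))..(Real.pi / h),
      pgf q (Complex.exp (t * Complex.I)) ^ n * Complex.exp (-(t * m * Complex.I)) =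
      ((2 * Real.pi / h * coeff m (PowerSeries.mk q ^ n) : ℝ) : ℂ) := by
  have hS := hasSum_coeff_mk_pow h0 hq n
  have hnn := coeff_mk_pow_nonneg h0 n
  have h1 := intervalIntegral.hasSum_integral_of_dominated_convergence (μ := volume)
    (a := -(Real.pi / h)) (b := Real.pi / h)
    (F := fun (j : ℕ) (t : ℝ) => ((coeff j (PowerSeries.mk q ^ n) : ℝ) : ℂ) *
      Complex.exp (t * Complex.I) ^ j * Complex.exp (-(t * m * Complex.I)))
    (f := fun t : ℝ => pgf q (Complex.exp (t * Complex.I)) ^ n *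
      Complex.exp (-(t * m * Complex.I)))
    (fun j _ => coeff j (PowerSeries.mk q ^ n))
    (fun j => Continuous.aestronglyMeasurable (by fun_prop))
    (fun j => Eventually.of_forall fun t _ => ?_)
    (Eventually.of_forall fun t _ => hS.summable) (by simp) (Eventually.of_forall fun t _ => ?_)
  · rw [← h1.tsum_eq, tsum_eq_single m]
    · have h2 (t : ℝ) : ((coeff m (PowerSeries.mk q ^ n) : ℝ) : ℂ) *
          Complex.exp (t * Complex.I) ^ m * Complex.exp (-(t * m * Complex.I)) =
          ((coeff m (PowerSeries.mk q ^ n) : ℝ) : ℂ) := by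
        rw [mul_assoc, ← Complex.exp_nat_mul, ← Complex.exp_add]
        have : (m : ℂ) * (t * Complex.I) + -(t * m * Complex.I) = 0 := by ring
        rw [this, Complex.exp_zero, mul_one]
      simp only [h2, intervalIntegral.integral_const]
      rw [Complex.real_smul, ← Complex.ofReal_mul]
      congr 1
      ring
    · intro j hj
      by_cases hc : coeff j (PowerSeries.mk q ^ n) = 0
      · simp [hc]
      · obtain ⟨a, ha⟩ := dvd_of_coeff_mk_pow_ne_zero hd hc
        obtain ⟨b, hb⟩ := hm
        have h2 (t : ℝ) : ((coeff j (PowerSeries.mk q ^ n) : ℝ) : ℂ) *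
            Complex.exp (t * Complex.I) ^ j * Complex.exp (-(t * m * Complex.I)) =
            ((coeff j (PowerSeries.mk q ^ n) : ℝ) : ℂ) *
              Complex.exp (t * (h * ((a : ℤ) - b) : ℤ) * Complex.I) := by
          rw [mul_assoc, ← Complex.exp_nat_mul, ← Complex.exp_add, hb]
          congr 2
          rw [ha]
          push_cast
          ring
        simp only [h2]
        rw [intervalIntegral.integral_const_mul, integral_exp_lattice hh, if_neg, mul_zero]
        intro hab
        apply hj
        rw [ha, hb, show a = b by omega]
  · rw [norm_mul, norm_mul, norm_pow, Complex.norm_exp_ofReal_mul_I, one_pow, mul_one,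
      Complex.norm_real, Real.norm_of_nonneg (hnn j)]
    have : -(t * m * Complex.I : ℂ) = ((-(t * m) : ℝ) : ℂ) * Complex.I := by push_cast; ring
    rw [this, Complex.norm_exp_ofReal_mul_I, mul_one]
  · have h3 := summable_norm_pgf_pow h0 hq.summable (Complex.norm_exp_ofReal_mul_I t).le n
    have h4 := h3.1.of_norm.hasSum
    rw [h3.2] at h4
    exact h4.mul_right _

section

variable (p : PMF ℕ)

theorem hasSum_toReal_pmf : HasSum (fun d => (p d).toReal) 1 := by
  have h := ENNReal.hasSum_toReal (f := p) (by rw [p.tsum_coe]; simp)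
  rwa [← ENNReal.tsum_toReal_eq p.apply_ne_top, p.tsum_coe, ENNReal.toReal_one] at h

theorem charFun_standardized (σ t : ℝ) (hσ : σ ≠ 0) :
    charFun (p.toMeasure.map fun j : ℕ => ((j : ℝ) - 1) / σ) (σ * t) =
      Complex.exp (-(t * Complex.I)) *
        pgf (fun d => (p d).toReal) (Complex.exp (t * Complex.I)) := by
  rw [charFun_apply_real, integral_map (by fun_prop) (by fun_prop), PMF.integral_eq_tsum, pgf,
    ← tsum_mul_left]
  · refine tsum_congr fun d => ?_
    rw [← Complex.exp_nat_mul, mul_left_comm, ← Complex.exp_add, Complex.real_smul]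
    congr 2
    have : (σ : ℂ) ≠ 0 := by exact_mod_cast hσ
    push_cast
    field_simp
    ring
  · refine Integrable.of_bound (by fun_prop) 1 (Eventually.of_forall fun j => ?_)
    rw [← Complex.ofReal_mul, Complex.norm_exp_ofReal_mul_I]

variable {p}

theorem pmf_zero_ne_zero (hL2 : MemLp (fun j : ℕ => (j : ℝ)) 2 p.toMeasure)
    (hmean : ∫ j : ℕ, (j : ℝ) ∂p.toMeasure = 1)
    (hvar : 0 < Var[fun j : ℕ => (j : ℝ); p.toMeasure]) : p 0 ≠ 0 := by
  intro h0
  have hint : Integrable (fun j : ℕ => (j : ℝ)) p.toMeasure := hL2.integrable (by norm_num)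
  have h1 : ∀ᵐ j : ℕ ∂p.toMeasure, 0 ≤ (j : ℝ) - 1 := by
    have : p.toMeasure {0} = 0 := by rw [p.toMeasure_apply_singleton _ (by measurability), h0]
    filter_upwards [measure_eq_zero_iff_ae_notMem.1 this] with j hj
    rw [sub_nonneg]
    exact_mod_cast Nat.one_le_iff_ne_zero.2 hj
  have h2 : ∫ j : ℕ, ((j : ℝ) - 1) ∂p.toMeasure = 0 := by
    rw [integral_sub hint (integrable_const _), hmean]
    simp
  have h3 := (integral_eq_zero_iff_of_nonneg_ae h1 (hint.sub (integrable_const _))).1 h2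
  have h4 : (fun j : ℕ => (j : ℝ)) =ᵐ[p.toMeasure] fun _ => 1 := by
    filter_upwards [h3] with j hj
    simpa [sub_eq_zero] using hj
  rw [variance_congr h4, variance_eq_integral (by fun_prop)] at hvar
  simp at hvar

theorem exists_pmf_ne_zero (hmean : ∫ j : ℕ, (j : ℝ) ∂p.toMeasure = 1) :
    ∃ d ∈ {d | p d ≠ 0}, d ≠ 0 := by
  by_contra! h
  have : (fun j : ℕ => (j : ℝ)) =ᵐ[p.toMeasure] fun _ => 0 := by
    rw [EventuallyEq, ae_iff_of_countable]
    intro j hj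
    rw [p.toMeasure_apply_singleton _ (by measurability)] at hj
    exact_mod_cast h j hj
  rw [integral_congr_ae this] at hmean
  simp at hmean

theorem standardized_mean (hL2 : MemLp (fun j : ℕ => (j : ℝ)) 2 p.toMeasure)
    (hmean : ∫ j : ℕ, (j : ℝ) ∂p.toMeasure = 1) (σ : ℝ) :
    ∫ j : ℕ, ((j : ℝ) - 1) / σ ∂p.toMeasure = 0 := by
  rw [integral_div, integral_sub (hL2.integrable (by norm_num)) (integrable_const _), hmean]
  simp

theorem standardized_sq (hmean : ∫ j : ℕ, (j : ℝ) ∂p.toMeasure = 1)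
    (hvar : 0 < Var[fun j : ℕ => (j : ℝ); p.toMeasure]) :
    ∫ j : ℕ, (((j : ℝ) - 1) / √(Var[fun j : ℕ => (j : ℝ); p.toMeasure])) ^ 2 ∂p.toMeasure = 1 := by
  simp only [div_pow]
  rw [integral_div, Real.sq_sqrt hvar.le, div_eq_one_iff_eq hvar.ne',
    variance_eq_integral (by fun_prop), hmean]

theorem exists_gaussian_bound (hL2 : MemLp (fun j : ℕ => (j : ℝ)) 2 p.toMeasure)
    (hmean : ∫ j : ℕ, (j : ℝ) ∂p.toMeasure = 1)
    (hvar : 0 < Var[fun j : ℕ => (j : ℝ); p.toMeasure]) {h : ℕ} (hh : 0 < h)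
    (hspan : ∀ w : ℂ, w ≠ 0 → (∀ d ∈ {d | p d ≠ 0}, w ^ d = 1) → w ^ h = 1) :
    ∃ c : ℝ, 0 < c ∧ ∀ t : ℝ, |t| ≤ Real.pi / h →
      ‖pgf (fun d => (p d).toReal) (Complex.exp (t * Complex.I))‖ ≤ Real.exp (-c * t ^ 2) := by
  set σ := √(Var[fun j : ℕ => (j : ℝ); p.toMeasure])
  have hσ0 : 0 < σ := Real.sqrt_pos.2 hvar
  set q : ℕ → ℝ := fun d => (p d).toReal
  have hq0 : ∀ d, 0 ≤ q d := fun d => ENNReal.toReal_nonneg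
  have hnorm (t : ℝ) : ‖pgf q (Complex.exp (t * Complex.I))‖ =
      ‖charFun (p.toMeasure.map fun j : ℕ => ((j : ℝ) - 1) / σ) (σ * t)‖ := by
    rw [charFun_standardized p σ t hσ0.ne', norm_mul]
    have : -(t * Complex.I : ℂ) = ((-t : ℝ) : ℂ) * Complex.I := by push_cast; ring
    rw [this, Complex.norm_exp_ofReal_mul_I, one_mul]
  have htaylor := taylor_charFun_two (P := p.toMeasure) (X := fun j : ℕ => ((j : ℝ) - 1) / σ)
    (by fun_prop) (standardized_mean hL2 hmean σ) (standardized_sq hmean hvar)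
  have hsmall := (htaylor.def (show (0 : ℝ) < 1 / 4 by norm_num)).and
    (eventually_abs_sub_lt 0 (show (0 : ℝ) < 1 by norm_num))
  obtain ⟨δ, hδ, hsmall⟩ := Metric.eventually_nhds_iff.1 hsmall
  have hnear (u : ℝ) (hu : |u| < δ) :
      ‖charFun (p.toMeasure.map fun j : ℕ => ((j : ℝ) - 1) / σ) u‖ ≤ Real.exp (-(u ^ 2 / 4)) := by
    obtain ⟨h1, h2⟩ := hsmall (y := u) (by simpa using hu)
    rw [sub_zero] at h2
    have h3 : u ^ 2 ≤ 1 := by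
      rw [← sq_abs]
      exact pow_le_one₀ (abs_nonneg u) h2.le
    have h4 : ‖(1 - (u : ℂ) ^ 2 / 2)‖ = 1 - u ^ 2 / 2 := by
      have : (1 - (u : ℂ) ^ 2 / 2) = ((1 - u ^ 2 / 2 : ℝ) : ℂ) := by push_cast; ring
      rw [this, Complex.norm_real, Real.norm_of_nonneg (by linarith)]
    have h5 : ‖(u : ℝ) ^ 2‖ = u ^ 2 := Real.norm_of_nonneg (sq_nonneg u)
    have h6 := norm_add_le (charFun (p.toMeasure.map fun j : ℕ => ((j : ℝ) - 1) / σ) u -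
      (1 - (u : ℂ) ^ 2 / 2)) (1 - (u : ℂ) ^ 2 / 2)
    rw [sub_add_cancel, h4] at h6
    rw [h5] at h1
    have := Real.add_one_le_exp (-(u ^ 2 / 4))
    linarith
  set A := Real.pi / h with hA
  have hh' : (0 : ℝ) < h := by exact_mod_cast hh
  have hA0 : 0 < A := div_pos Real.pi_pos hh'
  have hlt (t : ℝ) (ht : |t| ≤ A) (ht0 : t ≠ 0) :
      ‖pgf q (Complex.exp (t * Complex.I))‖ < 1 := by
    have hle := norm_pgf_le_one hq0 (hasSum_toReal_pmf p) (Complex.norm_exp_ofReal_mul_I t).le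
    refine lt_of_le_of_ne hle fun heq => ht0 ?_
    have h1 := hspan _ (Complex.exp_ne_zero (t * Complex.I)) fun d hd =>
      pow_eq_one_of_norm_pgf_eq_one hq0 (hasSum_toReal_pmf p)
        (ENNReal.toReal_ne_zero.2 ⟨pmf_zero_ne_zero hL2 hmean hvar, p.apply_ne_top 0⟩)
        (Complex.norm_exp_ofReal_mul_I t) heq
        (ENNReal.toReal_ne_zero.2 ⟨hd, p.apply_ne_top d⟩)
    rw [← Complex.exp_nat_mul, Complex.exp_eq_one_iff] at h1
    obtain ⟨l, hl⟩ := h1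
    have h2 : (h : ℝ) * t = l * (2 * Real.pi) := by
      have : (((h : ℝ) * t : ℝ) : ℂ) * Complex.I = ((l * (2 * Real.pi) : ℝ) : ℂ) * Complex.I := by
        push_cast
        linear_combination hl
      exact_mod_cast mul_right_cancel₀ Complex.I_ne_zero this
    have h3 : |(l : ℝ)| * (2 * Real.pi) ≤ Real.pi := by
      rw [← abs_of_pos (show 0 < 2 * Real.pi by positivity), ← abs_mul, ← h2, abs_mul,
        abs_of_pos hh']
      calc (h : ℝ) * |t| ≤ h * A := by gcongr
        _ = Real.pi := by rw [hA]; field_simp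
    have h4 : |(l : ℝ)| < 1 := by
      by_contra! h5
      nlinarith [Real.pi_pos]
    have h5 : l = 0 := Int.abs_lt_one_iff.1 (by exact_mod_cast h4)
    rw [h5, Int.cast_zero, zero_mul, mul_eq_zero] at h2
    exact h2.resolve_left hh'.ne'
  set K : Set ℝ := {t | |t| ≤ A ∧ δ ≤ σ * |t|}
  have hKc : IsCompact K := by
    refine (isCompact_Icc (a := -A) (b := A)).of_isClosed_subset ?_ fun t ht => abs_le.1 ht.1
    exact (isClosed_le continuous_abs continuous_const).inter
      (isClosed_le continuous_const (continuous_const.mul continuous_abs))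
  obtain ⟨ρ, hρ0, hρ1, hρ⟩ : ∃ ρ : ℝ, 0 < ρ ∧ ρ < 1 ∧ ∀ t ∈ K,
      ‖pgf q (Complex.exp (t * Complex.I))‖ ≤ ρ := by
    obtain hemp | hne := K.eq_empty_or_nonempty
    · exact ⟨1 / 2, by norm_num, by norm_num, by simp [hemp]⟩
    · obtain ⟨t0, ht0, hmax⟩ := hKc.exists_isMaxOn hne
        (continuous_pgf_exp hq0 (hasSum_toReal_pmf p).summable).norm.continuousOn
      have h1 := hlt t0 ht0.1 (by
        rintro rfl
        have := ht0.2
        simp only [abs_zero, mul_zero] at this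
        linarith)
      exact ⟨max (1 / 2) _, by positivity, max_lt (by norm_num) h1,
        fun t ht => le_max_of_le_right (hmax ht)⟩
  refine ⟨min (σ ^ 2 / 4) (-Real.log ρ / A ^ 2), ?_, fun t ht => ?_⟩
  · have := Real.log_neg hρ0 hρ1
    refine lt_min (by positivity) (div_pos (by linarith) (by positivity))
  · by_cases htδ : σ * |t| < δ
    · rw [hnorm]
      refine (hnear _ (by rwa [abs_mul, abs_of_pos hσ0])).trans (Real.exp_le_exp.2 ?_)
      have := mul_le_mul_of_nonneg_right (min_le_left (σ ^ 2 / 4) (-Real.log ρ / A ^ 2))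
        (sq_nonneg t)
      rw [mul_pow]
      linarith
    · refine (hρ t ⟨ht, not_lt.1 htδ⟩).trans ?_
      rw [← Real.exp_log hρ0]
      refine Real.exp_le_exp.2 ?_
      have h1 := mul_le_mul_of_nonneg_right (min_le_right (σ ^ 2 / 4) (-Real.log ρ / A ^ 2))
        (sq_nonneg t)
      have h2 : t ^ 2 ≤ A ^ 2 := by
        rw [← sq_abs t]
        gcongr
      have h3 : -Real.log ρ / A ^ 2 * t ^ 2 ≤ -Real.log ρ := by
        have := Real.log_neg hρ0 hρ1
        rw [div_mul_eq_mul_div, div_le_iff₀ (by positivity)]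
        gcongr
        linarith
      rw [Real.exp_log hρ0]
      linarith

end

section

variable {p : PMF ℕ}

theorem toReal_pmf_dvd {h : ℕ} (hdvd : ∀ d ∈ {d | p d ≠ 0}, h ∣ d) (d : ℕ)
    (hd : (p d).toReal ≠ 0) : h ∣ d :=
  hdvd d (ENNReal.toReal_ne_zero.1 hd).1

theorem exists_coeff_le (hL2 : MemLp (fun j : ℕ => (j : ℝ)) 2 p.toMeasure)
    (hmean : ∫ j : ℕ, (j : ℝ) ∂p.toMeasure = 1)
    (hvar : 0 < Var[fun j : ℕ => (j : ℝ); p.toMeasure]) {h : ℕ} (hh : 0 < h)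
    (hdvd : ∀ d ∈ {d | p d ≠ 0}, h ∣ d)
    (hspan : ∀ w : ℂ, w ≠ 0 → (∀ d ∈ {d | p d ≠ 0}, w ^ d = 1) → w ^ h = 1) :
    ∃ K : ℝ, 0 < K ∧ ∀ n : ℕ, 0 < n → ∀ m,
      coeff m (PowerSeries.mk (fun d => (p d).toReal) ^ n) ≤ K / √n := by
  obtain ⟨c, hc, hbound⟩ := exists_gaussian_bound hL2 hmean hvar hh hspan
  have hq0 : ∀ d, 0 ≤ (p d).toReal := fun d => ENNReal.toReal_nonneg
  have hh' : (0 : ℝ) < h := by exact_mod_cast hh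
  have hA : -(Real.pi / h) ≤ Real.pi / h := by
    have := div_pos Real.pi_pos hh'
    linarith
  refine ⟨h / (2 * Real.pi) * √(Real.pi / c), by positivity, fun n hn m => ?_⟩
  by_cases hm : h ∣ m
  · have hn' : (0 : ℝ) < n := by exact_mod_cast hn
    have hint := integrable_exp_neg_mul_sq (b := c * n) (by positivity)
    have h1 := intervalIntegral.norm_integral_le_of_norm_le (μ := volume) hA
      (f := fun t : ℝ => pgf (fun d => (p d).toReal) (Complex.exp (t * Complex.I)) ^ n *
        Complex.exp (-(t * m * Complex.I)))
      (g := fun t => Real.exp (-(c * n) * t ^ 2)) (Eventually.of_forall fun t ht => by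
        have h2 : -(t * m * Complex.I : ℂ) = ((-(t * m) : ℝ) : ℂ) * Complex.I := by
          push_cast; ring
        rw [norm_mul, norm_pow, h2, Complex.norm_exp_ofReal_mul_I, mul_one]
        refine (pow_le_pow_left₀ (norm_nonneg _) (hbound t (abs_le.2 ⟨ht.1.le, ht.2⟩)) n).trans
          (le_of_eq ?_)
        rw [← Real.exp_nat_mul]
        congr 1
        ring) hint.intervalIntegrable
    rw [integral_pgf_pow hq0 (hasSum_toReal_pmf p) hh (toReal_pmf_dvd hdvd) n hm,
      Complex.norm_real, Real.norm_of_nonneg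
        (mul_nonneg (by positivity) (coeff_mk_pow_nonneg hq0 n m)),
      intervalIntegral.integral_of_le hA] at h1
    have h3 := h1.trans (setIntegral_le_integral hint
      (Eventually.of_forall fun t => (Real.exp_pos _).le))
    rw [integral_gaussian, ← div_div, Real.sqrt_div (by positivity)] at h3
    rw [mul_div_assoc, ← div_le_iff₀' (by positivity)]
    refine le_trans (le_of_eq ?_) h3
    field_simp
  · rw [not_imp_comm.1 (dvd_of_coeff_mk_pow_ne_zero (toReal_pmf_dvd hdvd)) hm]
    positivity

theorem exists_le_coeff (hL2 : MemLp (fun j : ℕ => (j : ℝ)) 2 p.toMeasure)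
    (hmean : ∫ j : ℕ, (j : ℝ) ∂p.toMeasure = 1)
    (hvar : 0 < Var[fun j : ℕ => (j : ℝ); p.toMeasure]) {h : ℕ} (hh : 0 < h)
    (hdvd : ∀ d ∈ {d | p d ≠ 0}, h ∣ d)
    (hspan : ∀ w : ℂ, w ≠ 0 → (∀ d ∈ {d | p d ≠ 0}, w ^ d = 1) → w ^ h = 1) :
    ∃ K : ℝ, 0 < K ∧ ∀ᶠ N : ℕ in atTop, ∀ m, m + 1 = N → h ∣ m →
      K / √N ≤ coeff m (PowerSeries.mk (fun d => (p d).toReal) ^ N) := by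
  obtain ⟨c, hc, hbound⟩ := exists_gaussian_bound hL2 hmean hvar hh hspan
  have hq0 : ∀ d, 0 ≤ (p d).toReal := fun d => ENNReal.toReal_nonneg
  have hh' : (0 : ℝ) < h := by exact_mod_cast hh
  set A := Real.pi / h with hA
  have hA0 : 0 < A := div_pos Real.pi_pos hh'
  set σ := √(Var[fun j : ℕ => (j : ℝ); p.toMeasure])
  have hσ0 : 0 < σ := Real.sqrt_pos.2 hvar
  set ψ := charFun (p.toMeasure.map fun j : ℕ => ((j : ℝ) - 1) / σ) with hψ
  have hψc : Continuous ψ := continuous_charFun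
  have hψle (t : ℝ) (ht : |t| ≤ A) : ‖ψ (σ * t)‖ ≤ Real.exp (-c * t ^ 2) := by
    have : -(t * Complex.I : ℂ) = ((-t : ℝ) : ℂ) * Complex.I := by push_cast; ring
    rw [hψ, charFun_standardized p σ t hσ0.ne', norm_mul, this, Complex.norm_exp_ofReal_mul_I,
      one_mul]
    exact hbound t ht
  let f (N : ℕ) (t : ℝ) : ℂ := ψ (σ * t) ^ N * Complex.exp (t * Complex.I)
  have hlim : Tendsto (fun N : ℕ => ∫ s : ℝ, (Set.Ioc (-(A * √N)) (A * √N)).indicator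
      (fun s => f N (s / √N)) s) atTop (𝓝 (∫ s : ℝ, Complex.exp (-((σ * s : ℝ) : ℂ) ^ 2 / 2))) := by
    refine tendsto_integral_of_dominated_convergence (fun s => Real.exp (-c * s ^ 2))
      (fun N => ?_) (integrable_exp_neg_mul_sq hc) (fun N => Eventually.of_forall fun s => ?_)
      (Eventually.of_forall fun s => ?_)
    · refine AEStronglyMeasurable.indicator (Continuous.aestronglyMeasurable ?_) measurableSet_Ioc
      fun_prop
    · rw [Set.indicator_apply]
      split_ifs with hs
      · have hN : 0 < √(N : ℝ) := by
          by_contra! hN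
          have : √(N : ℝ) = 0 := le_antisymm hN (Real.sqrt_nonneg _)
          simp [this] at hs
        have hs' : |s / √N| ≤ A := by
          rw [abs_div, abs_of_pos hN, div_le_iff₀ hN]
          exact abs_le.2 ⟨hs.1.le, hs.2⟩
        simp only [f]
        rw [norm_mul, norm_pow, Complex.norm_exp_ofReal_mul_I, mul_one]
        refine (pow_le_pow_left₀ (norm_nonneg _) (hψle _ hs') N).trans (le_of_eq ?_)
        rw [← Real.exp_nat_mul]
        congr 1
        have : (N : ℝ) = √N ^ 2 := (Real.sq_sqrt (Nat.cast_nonneg N)).symm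
        rw [div_pow, ← this]
        have : (N : ℝ) ≠ 0 := (Real.sqrt_pos.1 hN).ne'
        field_simp
      · rw [norm_zero]
        exact (Real.exp_pos _).le
    · have hsqrt : Tendsto (fun N : ℕ => √(N : ℝ)) atTop atTop :=
        Real.tendsto_sqrt_atTop.comp tendsto_natCast_atTop_atTop
      have h1 : ∀ᶠ N : ℕ in atTop, s ∈ Set.Ioc (-(A * √N)) (A * √N) := by
        filter_upwards [(hsqrt.const_mul_atTop hA0).eventually_gt_atTop |s|] with N hN
        exact ⟨(abs_lt.1 hN).1, (abs_lt.1 hN).2.le⟩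
      have h2 := tendsto_charFun_inv_sqrt_mul_pow (P := p.toMeasure)
        (X := fun j : ℕ => ((j : ℝ) - 1) / σ) (by fun_prop) (standardized_mean hL2 hmean σ)
        (standardized_sq hmean hvar) (σ * s)
      have h3 : Tendsto (fun N : ℕ => Complex.exp (((s / √N : ℝ) : ℂ) * Complex.I)) atTop
          (𝓝 1) := by
        have h4 : Tendsto (fun N : ℕ => s / √(N : ℝ)) atTop (𝓝 0) :=
          hsqrt.const_div_atTop s
        have h5 : Continuous fun t : ℝ => Complex.exp (t * Complex.I) := by fun_prop
        simpa [Function.comp_def] using (h5.tendsto 0).comp h4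
      have h4 := h2.mul h3
      rw [mul_one] at h4
      refine h4.congr' ?_
      filter_upwards [h1] with N hN
      rw [Set.indicator_of_mem hN]
      simp only [f]
      rw [show σ * (s / √N) = (√N)⁻¹ * (σ * s) by ring]
  have hgauss : ∫ s : ℝ, Complex.exp (-((σ * s : ℝ) : ℂ) ^ 2 / 2) =
      ((√(Real.pi / (σ ^ 2 / 2)) : ℝ) : ℂ) := by
    rw [← integral_gaussian, ← integral_complex_ofReal]
    congr 1
    funext s
    push_cast
    congr 1
    ring
  rw [hgauss] at hlim
  have hnorm := hlim.norm
  rw [Complex.norm_real, Real.norm_of_nonneg (Real.sqrt_nonneg _)] at hnorm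
  set L := √(Real.pi / (σ ^ 2 / 2))
  have hL0 : 0 < L := Real.sqrt_pos.2 (by positivity)
  refine ⟨h / (2 * Real.pi) * (L / 2), by positivity, ?_⟩
  filter_upwards [hnorm.eventually_const_lt (half_lt_self hL0), eventually_gt_atTop 0]
    with N hN hN0 m hm hdm
  have hN' : 0 < √(N : ℝ) := Real.sqrt_pos.2 (by exact_mod_cast hN0)
  have hAN : -(A * √N) ≤ A * √N := by
    have : 0 < A * √N := by positivity
    linarith
  rw [integral_indicator measurableSet_Ioc, ← intervalIntegral.integral_of_le hAN,
    intervalIntegral.integral_comp_div _ hN'.ne', ← neg_mul, mul_div_cancel_right₀ _ hN'.ne',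
    mul_div_cancel_right₀ _ hN'.ne'] at hN
  have hf (t : ℝ) : f N t = pgf (fun d => (p d).toReal) (Complex.exp (t * Complex.I)) ^ N *
      Complex.exp (-(t * m * Complex.I)) := by
    simp only [f, hψ]
    rw [charFun_standardized p σ t hσ0.ne', mul_pow, ← Complex.exp_nat_mul, mul_right_comm,
      ← Complex.exp_add, mul_comm, ← hm]
    congr 2
    push_cast
    ring
  simp only [hf] at hN
  rw [hA, integral_pgf_pow hq0 (hasSum_toReal_pmf p) hh (toReal_pmf_dvd hdvd) N hdm, norm_smul,
    Complex.norm_real, Real.norm_of_nonneg hN'.le, Real.norm_of_nonneg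
      (mul_nonneg (by positivity) (coeff_mk_pow_nonneg hq0 N m))] at hN
  rw [div_le_iff₀ hN', ← le_div_iff₀' (by positivity)]
  refine hN.le.trans (le_of_eq ?_)
  field_simp

theorem coeff_mk_pow_eq_ofReal (n m : ℕ) : coeff m (PowerSeries.mk p ^ n) =
    ENNReal.ofReal (coeff m (PowerSeries.mk (fun d => (p d).toReal) ^ n)) := by
  have hq0 : ∀ d, 0 ≤ (p d).toReal := fun d => ENNReal.toReal_nonneg
  induction n generalizing m with
  | zero =>
    simp only [pow_zero, coeff_one]
    split_ifs <;> simp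
  | succ n ih =>
    rw [pow_succ', coeff_mul, pow_succ', coeff_mul, ENNReal.ofReal_sum_of_nonneg]
    · refine Finset.sum_congr rfl fun ij _ => ?_
      rw [ih, coeff_mk, coeff_mk, ENNReal.ofReal_mul (hq0 _), ENNReal.ofReal_toReal (p.apply_ne_top _)]
    · intro ij _
      rw [coeff_mk]
      exact mul_nonneg (hq0 _) (coeff_mk_pow_nonneg hq0 _ _)

/-- Consequence of the local limit theorem: up to a constant, the sum of `n` independent offspring
numbers is not more likely to have any given value than the sum of `n + 1` of them is to be `n`,
if the latter is possible at all. -/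
theorem exists_coeff_le_mul_coeff (hL2 : MemLp (fun j : ℕ => (j : ℝ)) 2 p.toMeasure)
    (hmean : ∫ j : ℕ, (j : ℝ) ∂p.toMeasure = 1)
    (hvar : 0 < Var[fun j : ℕ => (j : ℝ); p.toMeasure]) :
    ∃ K : ℝ≥0, ∀ n, coeff n (PowerSeries.mk p ^ (n + 1)) ≠ 0 → ∀ m,
      coeff m (PowerSeries.mk p ^ n) ≤ K * coeff n (PowerSeries.mk p ^ (n + 1)) := by
  obtain ⟨h, hh, hdvd, hspan⟩ := exists_span {d | p d ≠ 0} (exists_pmf_ne_zero hmean)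
  obtain ⟨K₁, hK₁, hup⟩ := exists_coeff_le hL2 hmean hvar hh hdvd hspan
  obtain ⟨K₂, hK₂, hlow⟩ := exists_le_coeff hL2 hmean hvar hh hdvd hspan
  obtain ⟨N₀, hN₀⟩ := eventually_atTop.1 hlow
  have hq0 : ∀ d, 0 ≤ (p d).toReal := fun d => ENNReal.toReal_nonneg
  obtain ⟨b, hb⟩ : ∃ b : ℕ → ℕ → ℝ, ∀ n m,
    coeff m (PowerSeries.mk (fun d => (p d).toReal) ^ n) = b n m := ⟨_, fun _ _ => rfl⟩
  have hb0 (n m : ℕ) : 0 ≤ b n m := by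
    rw [← hb]
    exact coeff_mk_pow_nonneg hq0 n m
  have hb1 (n m : ℕ) : b n m ≤ 1 := by
    have hsum := hasSum_coeff_mk_pow hq0 (hasSum_toReal_pmf p) n
    simp only [hb] at hsum
    exact le_hasSum hsum m fun j _ => hb0 n j
  have hS0 : 0 ≤ ∑ n ∈ Finset.range (N₀ + 1), (b (n + 1) n)⁻¹ :=
    Finset.sum_nonneg fun n _ => inv_nonneg.2 (hb0 _ _)
  refine ⟨(2 * K₁ / K₂ + ∑ n ∈ Finset.range (N₀ + 1), (b (n + 1) n)⁻¹).toNNReal,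
    fun n hn m => ?_⟩
  have hpos : 0 < b (n + 1) n := by
    rw [coeff_mk_pow_eq_ofReal, hb] at hn
    exact ENNReal.ofReal_pos.1 (pos_iff_ne_zero.2 hn)
  rw [coeff_mk_pow_eq_ofReal, coeff_mk_pow_eq_ofReal, hb, hb, ENNReal.ofNNReal_toNNReal,
    ← ENNReal.ofReal_mul (by positivity)]
  refine ENNReal.ofReal_le_ofReal ?_
  rw [add_mul]
  by_cases hn' : n < N₀ + 1
  · have h1 : (b (n + 1) n)⁻¹ ≤ ∑ n ∈ Finset.range (N₀ + 1), (b (n + 1) n)⁻¹ :=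
      Finset.single_le_sum (f := fun n => (b (n + 1) n)⁻¹) (fun n _ => inv_nonneg.2 (hb0 _ _))
        (Finset.mem_range.2 hn')
    have h2 := mul_le_mul_of_nonneg_right h1 hpos.le
    rw [inv_mul_cancel₀ hpos.ne'] at h2
    have h3 : 0 ≤ 2 * K₁ / K₂ * b (n + 1) n := by positivity
    linarith [hb1 n m]
  · have hnpos : 0 < n := by omega
    have hn0 : (0 : ℝ) < n := by exact_mod_cast hnpos
    have hdn : h ∣ n := dvd_of_coeff_mk_pow_ne_zero (toReal_pmf_dvd hdvd)
      (by rw [hb (n + 1) n]; exact hpos.ne')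
    have h1 := hup n hnpos m
    have h2 := hN₀ (n + 1) (by omega) n rfl hdn
    rw [hb] at h1 h2
    have h3 : 0 ≤ (∑ n ∈ Finset.range (N₀ + 1), (b (n + 1) n)⁻¹) * b (n + 1) n := by positivity
    have h4 : √((n + 1 : ℕ) : ℝ) ≤ 2 * √n := by
      rw [Real.sqrt_le_left (by positivity), mul_pow, Real.sq_sqrt hn0.le]
      have : (1 : ℝ) ≤ n := by exact_mod_cast hnpos
      push_cast
      linarith
    have h5 : K₁ / √n ≤ 2 * K₁ / K₂ * b (n + 1) n := by
      calc K₁ / √n = 2 * K₁ / (2 * √n) := by field_simp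
        _ ≤ 2 * K₁ / √((n + 1 : ℕ) : ℝ) := by gcongr
        _ = 2 * K₁ / K₂ * (K₂ / √((n + 1 : ℕ) : ℝ)) := by field_simp
        _ ≤ _ := by gcongr
    linarith

end

namespace PlaneTree

instance instDiscreteMeasurableSpace : DiscreteMeasurableSpace PlaneTree := ⟨fun _ => trivial⟩

theorem familyTree_eq_iff (x : List ℕ → ℕ) (τ : PlaneTree) :
    familyTree x = (τ.verts : Set (List ℕ)) ↔ ∀ v ∈ τ.verts, x v = τ.outdegree v := by
  have hnil : [] ∈ familyTree x := by
    intro v i h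
    simp at h
  have hconcat (u : List ℕ) (i : ℕ) :
      u ++ [i] ∈ familyTree x ↔ u ∈ familyTree x ∧ i < x u := by
    constructor
    · exact fun h => ⟨fun v j hv => h v j (hv.trans (List.prefix_append _ _)),
        h u i (List.prefix_refl _)⟩
    · rintro ⟨h, hi⟩ v j hv
      obtain heq | hv := List.prefix_concat_iff.1 hv
      · obtain ⟨rfl, h1⟩ := List.append_inj' heq rfl
        simp only [List.cons.injEq, and_true] at h1
        rwa [h1]
      · exact h v j hv
  constructor
  · intro h v hv
    refine (outdegree_eq fun i => ?_).symm
    have hv' : v ∈ familyTree x := by rw [h]; exact hv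
    rw [← Finset.mem_coe, ← h, hconcat]
    exact and_iff_right hv'
  · intro h
    ext u
    rw [Finset.mem_coe]
    induction u using List.reverseRecOn with
    | nil => exact iff_of_true hnil τ.root_mem
    | append_singleton u i ih =>
      rw [hconcat, ih, append_mem_iff]
      constructor
      · rintro ⟨hu, hi⟩
        rwa [← h u hu]
      · intro hi
        have hu := τ.parent_mem u i ((append_mem_iff _ _ _).2 hi)
        exact ⟨hu, by rwa [h u hu]⟩

theorem offspringLaw_familyTree_eq (p : PMF ℕ) (τ : PlaneTree) :
    offspringLaw p {x | familyTree x = (τ.verts : Set (List ℕ))} = τ.weight p := by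
  have h : {x | familyTree x = (τ.verts : Set (List ℕ))} =
      Set.pi τ.verts fun v => {τ.outdegree v} := by
    ext x
    simp [familyTree_eq_iff, Set.mem_pi]
  rw [h, offspringLaw, Measure.infinitePi_pi _ fun _ _ => measurableSet_singleton _]
  exact Finset.prod_congr rfl fun v _ =>
    p.toMeasure_apply_singleton _ (measurableSet_singleton _)

theorem lintegral_gwLaw (p : PMF ℕ) (f : PlaneTree → ℝ≥0∞) :
    ∫⁻ τ, f τ ∂(gwLaw p) = ∑' τ : PlaneTree, τ.weight p * f τ := by
  rw [gwLaw, lintegral_sum_measure]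
  simp [offspringLaw_familyTree_eq]

theorem gwLaw_size (p : PMF ℕ) (n : ℕ) :
    gwLaw p {τ | τ.size = n} = ∑' τ : PlaneTree, if τ.size = n then τ.weight p else 0 := by
  rw [← lintegral_indicator_one (MeasurableSet.of_discrete), lintegral_gwLaw]
  simp [Set.indicator_apply]

theorem lintegral_condTreeLaw (p : PMF ℕ) (n : ℕ) (f : PlaneTree → ℝ≥0∞) :
    ∫⁻ τ, f τ ∂(condTreeLaw p n) = (gwLaw p {τ | τ.size = n})⁻¹ *
      ∑' τ : PlaneTree, if τ.size = n then τ.weight p * f τ else 0 := by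
  rw [condTreeLaw, ProbabilityTheory.cond, lintegral_smul_measure,
    ← lintegral_indicator (MeasurableSet.of_discrete), lintegral_gwLaw, smul_eq_mul]
  simp [Set.indicator_apply]

theorem lintegral_randomFringeLaw (p : PMF ℕ) (n : ℕ) (f : PlaneTree → ℝ≥0∞) :
    ∫⁻ τ, f τ ∂(randomFringeLaw p n) =
      ∫⁻ τ, (τ.size : ℝ≥0∞)⁻¹ * fringeSum f τ ∂(condTreeLaw p n) := by
  rw [randomFringeLaw, Measure.lintegral_bind Measurable.of_discrete.aemeasurable
    Measurable.of_discrete.aemeasurable]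
  refine lintegral_congr fun τ => ?_
  let _ : MeasurableSpace τ.Vertex := ⊤
  have _ : DiscreteMeasurableSpace τ.Vertex := ⟨fun _ => trivial⟩
  rw [← PMF.toMeasure_map (f := τ.fringe) (PMF.uniformOfFintype τ.Vertex) Measurable.of_discrete, lintegral_map Measurable.of_discrete
    Measurable.of_discrete, lintegral_fintype, fringeSum, Finset.mul_sum]
  refine Finset.sum_congr rfl fun v _ => ?_
  rw [PMF.toMeasure_apply_singleton _ _ (measurableSet_singleton _),
    PMF.uniformOfFintype_apply, mul_comm, size, Fintype.card_coe]

theorem lintegral_Q_randomFringeLaw (p : PMF ℕ) {k : ℕ} (hk : 1 ≤ k) (n : ℕ) :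
    ∫⁻ τ, (τ.Q k : ℝ≥0∞) ∂(randomFringeLaw p n) =
      (n : ℝ≥0∞)⁻¹ * ∫⁻ τ, (τ.P k : ℝ≥0∞) ∂(condTreeLaw p n) := by
  rw [lintegral_randomFringeLaw, lintegral_condTreeLaw, lintegral_condTreeLaw, mul_left_comm]
  congr 1
  rw [← ENNReal.tsum_mul_left]
  refine tsum_congr fun τ => ?_
  split_ifs with h
  · rw [h, P_eq_sum_Q hk, Nat.cast_sum, fringeSum, mul_left_comm]
  · simp

theorem lintegral_P_condTreeLaw_le (p : PMF ℕ) {k : ℕ} (hk : 1 ≤ k) (n : ℕ) (D : ℝ≥0∞)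
    (h : coeff n (PowerSeries.mk (fun d => p d * (d * (d - 1) : ℕ)) * PowerSeries.mk p ^ n) ≤
      D * coeff n (PowerSeries.mk p ^ (n + 1))) :
    ∫⁻ τ, (τ.P k : ℝ≥0∞) ∂(condTreeLaw p (n + 1)) ≤ (2 + D) * (n + 1 : ℕ) * k := by
  have hk' : (1 : ℝ≥0∞) ≤ k := by exact_mod_cast hk
  rw [lintegral_condTreeLaw]
  have h1 : ∑' τ : PlaneTree, (if τ.size = n + 1 then τ.weight p * (τ.P k : ℝ≥0∞) else 0) ≤
      ∑' τ : PlaneTree, (if τ.size = n + 1 then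
        τ.weight p * fringeSum (fun σ => ((σ.rootPairs k).card : ℝ≥0∞)) τ else 0) := by
    refine ENNReal.tsum_le_tsum fun τ => ?_
    split_ifs
    · gcongr
      rw [P_eq_sum_Q hk, Nat.cast_sum, fringeSum]
      refine Finset.sum_le_sum fun v _ => ?_
      rw [← two_mul_Q hk]
      exact_mod_cast Nat.le_mul_of_pos_left _ two_pos
    · exact le_rfl
  calc _ ≤ (gwLaw p {τ | τ.size = n + 1})⁻¹ *
        (2 * coeff n (PowerSeries.mk p ^ (n + 1)) + k *
          (D * coeff n (PowerSeries.mk p ^ (n + 1)))) := by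
        gcongr
        exact h1.trans ((tsum_fringeSum_rootPairs_le p hk n).trans (by gcongr))
    _ ≤ (gwLaw p {τ | τ.size = n + 1})⁻¹ *
        (k * (2 * coeff n (PowerSeries.mk p ^ (n + 1))) + k *
          (D * coeff n (PowerSeries.mk p ^ (n + 1)))) := by
        gcongr _ * (?_ + _)
        exact le_mul_of_one_le_left' hk'
    _ = (gwLaw p {τ | τ.size = n + 1})⁻¹ * gwLaw p {τ | τ.size = n + 1} *
        ((2 + D) * (n + 1 : ℕ) * k) := by
        rw [← tsum_weight_size, ← gwLaw_size]
        ring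
    _ ≤ _ := mul_le_of_le_one_left' (ENNReal.inv_mul_le_one _)

end PlaneTree

theorem tsum_pmf_mul_ne_top {p : PMF ℕ} (hL2 : MemLp (fun j : ℕ => (j : ℝ)) 2 p.toMeasure) :
    ∑' d, p d * (d * (d - 1) : ℕ) ≠ ∞ := by
  have h := hL2.integrable_sq.lintegral_lt_top
  rw [lintegral_countable'] at h
  refine (lt_of_le_of_lt (ENNReal.tsum_le_tsum fun d => ?_) h).ne
  rw [p.toMeasure_apply_singleton _ (measurableSet_singleton _), mul_comm]
  gcongr
  rw [← ENNReal.ofReal_natCast]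
  refine ENNReal.ofReal_le_ofReal ?_
  rw [sq]
  exact_mod_cast Nat.mul_le_mul_left d (Nat.sub_le d 1)

theorem theorem2p1 (p : PMF ℕ)
    (hL2 : MemLp (fun j : ℕ => (j : ℝ)) 2 p.toMeasure)
    (hmean : ∫ j : ℕ, (j : ℝ) ∂p.toMeasure = 1)
    (hvar : 0 < Var[fun j : ℕ => (j : ℝ); p.toMeasure]) :
    (∃ C : ℝ≥0, 0 < C ∧ ∀ k n : ℕ, 1 ≤ k → 1 ≤ n → CondTreeExists p n →
      ∫⁻ τ, (τ.Q k : ℝ≥0∞) ∂(randomFringeLaw p n) ≤ C * k) ∧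
    (∀ C : ℝ≥0,
      (∀ k n : ℕ, 1 ≤ k → 1 ≤ n → CondTreeExists p n →
        ∫⁻ τ, (τ.Q k : ℝ≥0∞) ∂(randomFringeLaw p n) ≤ C * k) ↔
      (∀ k n : ℕ, 1 ≤ k → 1 ≤ n → CondTreeExists p n →
        ∫⁻ τ, (τ.P k : ℝ≥0∞) ∂(condTreeLaw p n) ≤ C * n * k)) := by
  have hequiv (C : ℝ≥0∞) (k n : ℕ) (hk : 1 ≤ k) (hn : 1 ≤ n) :
      ∫⁻ τ, (τ.Q k : ℝ≥0∞) ∂(randomFringeLaw p n) ≤ C * k ↔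
        ∫⁻ τ, (τ.P k : ℝ≥0∞) ∂(condTreeLaw p n) ≤ C * n * k := by
    rw [PlaneTree.lintegral_Q_randomFringeLaw p hk, mul_comm, ← div_eq_mul_inv,
      ENNReal.div_le_iff (by exact_mod_cast (by omega : n ≠ 0)) (by simp), mul_right_comm]
  refine ⟨?_, fun C => forall₄_congr fun k n hk hn => imp_congr_right fun _ =>
    hequiv C k n hk hn⟩
  obtain ⟨K, hK⟩ := exists_coeff_le_mul_coeff hL2 hmean hvar
  obtain ⟨M, hM⟩ : ∃ M : ℝ≥0, (M : ℝ≥0∞) = ∑' d, p d * (d * (d - 1) : ℕ) :=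
    ⟨_, ENNReal.coe_toNNReal (tsum_pmf_mul_ne_top hL2)⟩
  refine ⟨2 + M * K, by positivity, fun k n hk hn hex => (hequiv _ k n hk hn).2 ?_⟩
  obtain ⟨n, rfl⟩ := Nat.exists_eq_add_of_le' hn
  push_cast
  refine (PlaneTree.lintegral_P_condTreeLaw_le p hk n (M * K) ?_).trans_eq (by push_cast; rfl)
  have hne : coeff n (PowerSeries.mk p ^ (n + 1)) ≠ 0 := by
    rw [← PlaneTree.tsum_weight_size, ← PlaneTree.gwLaw_size]
    exact mul_ne_zero (by exact_mod_cast n.succ_ne_zero) hex.ne'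
  have hconv := tsum_mul_ite_coeff (fun d => p d * (d * (d - 1) : ℕ)) (PowerSeries.mk p ^ n) n 0
  simp only [add_zero, Nat.zero_le, if_true, Nat.sub_zero] at hconv
  rw [← hconv, hM, mul_assoc, ← ENNReal.tsum_mul_right]
  refine ENNReal.tsum_le_tsum fun d => ?_
  gcongr
  split_ifs
  · exact hK n hne _
  · exact zero_le
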